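/- **Theorem (Determinant Class Theorem).** Let $Y$ be a connected simplicial complex, and let $\pi$ be an amenable discrete group which acts freely and simplicially on $Y$ such that $Y/\pi$ is finite (there are only finitely many $\pi$-orbits of simplices). Then $Y$ is of determinant class: for every $j\ge 0$, $$\int_{0^+}^{1}\log\lambda\;dF_j(\lambda) > -\infty .$$ Here $\pi$ is amenable if for every finite $K\subset\pi$ and every $\varepsilon>0$ there is a nonempty finite $\Lambda\subset\pi$ with $\#(g\Lambda\,\triangle\,\Lambda)\le\varepsilon\,\#\Lambda$ for all $g\in K$; the action is free if it is free on the geometric realization of $Y$, i.e. no $g\ne 1$ maps a simplex to itself. Let $C^j_{(2)}(Y)$ be the Hilbert space of square-summable complex simplicial $j$-cochains of $Y$, with orthonormal basis $\delta_\sigma$ indexed by the $j$-simplices $\sigma$ (each with a chosen orientation; we orient them by a total order on the vertices), let $d_j:C^j_{(2)}(Y)\to C^{j+1}_{(2)}(Y)$ be the (bounded) simplicial coboundary operator, with $d_{-1}=0$, and let $\Delta_j=d_{j-1}d_{j-1}^*+d_j^*d_j$ be the combinatorial Laplacian. Its spectral density function is $$F_j(\lambda)=\mathrm{Tr}_\pi\big(\chi_{[0,\lambda]}(\Delta_j)\big)=\sum_{\sigma}\big\langle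 \chi_{[0,\lambda]}(\Delta_j)\,\delta_{\tilde\sigma},\delta_{\tilde\sigma}\big\rangle ,$$ where the sum runs over the $\pi$-orbits $\sigma$ of $j$-simplices of $Y$ and $\tilde\sigma$ is any representative of $\sigma$. The integral is the Lebesgue–Stieltjes integral over $(0,1]$ with respect to the monotone, right-continuous function $F_j$. -/

import Mathlib

open scoped Pointwise symmDiff Topology ENNReal

namespace DetClass

noncomputable section

/-! ### Simplicial complexes and group actions -/

/-- Følner's condition for a discrete group: for every finite set `K` of group elements and every
`ε > 0` there is a nonempty finite set `Λ` with `#(gΛ ∆ Λ) ≤ ε #Λ` for all `g ∈ K`. -/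
def IsAmenable (G : Type*) [Group G] : Prop :=
  ∀ (K : Set G) (ε : ℝ), K.Finite → 0 < ε →
    ∃ Λ : Set G, Λ.Finite ∧ Λ.Nonempty ∧ ∀ g ∈ K, (((g • Λ) ∆ Λ).ncard : ℝ) ≤ ε * (Λ.ncard : ℝ)

/-- The graph formed by the vertices and the edges of `Y`. -/
def oneSkeleton {V : Type*} [LinearOrder V] (Y : AbstractSimplicialComplex V) : SimpleGraph V where
  Adj v w := v ≠ w ∧ ({v, w} : Finset V) ∈ Y.faces
  symm := ⟨fun v w h => ⟨h.1.symm, by simpa [Finset.pair_comm] using h.2⟩⟩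
  loopless := ⟨fun _ h => h.1 rfl⟩

/-- `Y` is connected (in particular nonempty): any two vertices are joined by an edge path. -/
def IsConnectedComplex {V : Type*} [LinearOrder V] (Y : AbstractSimplicialComplex V) : Prop :=
  (oneSkeleton Y).Connected

/-- The action of `G` on the vertices of `Y` induces a free simplicial action on `Y` with finite
quotient. Since `G` permutes the simplices, an element fixes a point of the geometric realization
if and only if it maps the simplex carrying that point to itself; so the action on the geometric
realization is free if and only if no `g ≠ 1` maps a simplex to itself. -/
structure FreeCocompact (G : Type*) {V : Type*} [Group G] [LinearOrder V] [MulAction G V]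
    (Y : AbstractSimplicialComplex V) : Prop where
  simplicial : ∀ (g : G), ∀ s ∈ Y.faces, g • s ∈ Y.faces
  free : ∀ (g : G), ∀ s ∈ Y.faces, g • s = s → g = 1
  finite_quotient : {O : Set (Finset V) | ∃ s ∈ Y.faces, O = MulAction.orbit G s}.Finite

/-- The `j`-simplices of `Y`. -/
def Simplex {V : Type*} (Y : AbstractSimplicialComplex V) (j : ℕ) : Type _ :=
  {s : Finset V // s ∈ Y.faces ∧ s.card = j + 1}

instance {V : Type*} [LinearOrder V] (Y : AbstractSimplicialComplex V) (j : ℕ) :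
    DecidableEq (Simplex Y j) :=
  inferInstanceAs (DecidableEq {s : Finset V // s ∈ Y.faces ∧ s.card = j + 1})

/-- The `j`-face of a `(j+1)`-simplex opposite to one of its vertices. -/
def Simplex.face {V : Type*} [LinearOrder V] {Y : AbstractSimplicialComplex V} {j : ℕ}
    (τ : Simplex Y (j + 1)) (v : {v // v ∈ τ.1}) : Simplex Y j :=
  ⟨τ.1.erase v.1, by
    have hc : (τ.1.erase v.1).card = j + 1 := by
      rw [Finset.card_erase_of_mem v.2, τ.2.2]; rfl
    have hn : (τ.1.erase v.1).Nonempty := by rw [← Finset.card_pos, hc]; omega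
    exact ⟨(Y.isRelLowerSet_faces τ.2.1).2 (Finset.erase_subset _ _) hn, hc⟩⟩

/-! ### The `L²` cochain complex -/

/-- The simplicial coboundary `(df)(τ) = ∑ᵢ (-1)ⁱ f([v₀, …, v̂ᵢ, …, v_{j+1}])`, where every simplex
carries the orientation `τ = [v₀, …, v_{j+1}]`, `v₀ < ⋯ < v_{j+1}`, given by the order of `V`. An
alternating cochain on oriented simplices is the same thing as a function on the simplices with
these orientations. -/
def coboundaryFun {V : Type*} [LinearOrder V] {Y : AbstractSimplicialComplex V} {j : ℕ}
    (f : Simplex Y j → ℂ) (τ : Simplex Y (j + 1)) : ℂ :=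
  ∑ v : {v // v ∈ τ.1}, (-1 : ℂ) ^ (τ.1.filter (· < v.1)).card * f (τ.face v)

/-- The Hilbert space of square summable `j`-cochains. -/
abbrev L2Cochain {V : Type*} (Y : AbstractSimplicialComplex V) (j : ℕ) : Type _ :=
  lp (fun _ : Simplex Y j => ℂ) 2

/-- For each `j` there is a bound on the number of `(j+1)`-simplices containing a `j`-simplex. -/
def UniformlyLocallyFinite {V : Type*} (Y : AbstractSimplicialComplex V) : Prop :=
  ∀ j : ℕ, ∃ M : ℕ, ∀ σ : Simplex Y j, ∀ S : Finset (Simplex Y (j + 1)),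
    (∀ τ ∈ S, σ.1 ⊆ τ.1) → S.card ≤ M

theorem FreeCocompact.uniformlyLocallyFinite {G V : Type*} [Group G] [LinearOrder V]
    [MulAction G V] {Y : AbstractSimplicialComplex V} (h : FreeCocompact G Y) :
    UniformlyLocallyFinite Y := by
  classical
  intro j
  have hT : ∃ T : Finset (Finset V), ∀ s ∈ Y.faces, ∃ g : G, g • s ∈ T := by
    choose! r hr using fun (O : Set (Finset V)) (hO : ∃ s ∈ Y.faces, O = MulAction.orbit G s) =>
      (show ∃ s, s ∈ O by obtain ⟨s, -, rfl⟩ := hO; exact ⟨s, MulAction.mem_orbit_self s⟩)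
    refine ⟨h.finite_quotient.toFinset.image r, fun s hs => ?_⟩
    obtain ⟨g, hg⟩ := hr (MulAction.orbit G s) ⟨s, hs, rfl⟩
    exact ⟨g, Finset.mem_image.2 ⟨MulAction.orbit G s, by simpa using ⟨s, hs, rfl⟩, hg.symm⟩⟩
  obtain ⟨T, hT⟩ := hT
  refine ⟨(T.sigma fun t => t.powerset).card, fun σ S hS => ?_⟩
  choose! g hg using hT
  refine Finset.card_le_card_of_injOn (fun τ => ⟨g τ.1 • τ.1, g τ.1 • σ.1⟩) ?_ ?_
  · intro τ hτ
    have h1 := hg τ.1 τ.2.1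
    have h2 := Finset.smul_finset_subset_smul_finset (a := g τ.1) (hS τ hτ)
    exact Finset.mem_coe.2 (Finset.mem_sigma.2 ⟨h1, Finset.mem_powerset.2 h2⟩)
  · intro τ _ τ' _ he
    simp only [Sigma.mk.injEq, heq_eq_eq] at he
    have h1 : g τ'.1 = g τ.1 := by
      have h2 : ((g τ'.1)⁻¹ * g τ.1) • σ.1 = σ.1 := by rw [mul_smul, he.2, inv_smul_smul]
      exact inv_mul_eq_one.1 (h.free _ _ σ.2.1 h2)
    rw [h1] at he
    exact Subtype.ext (MulAction.injective _ he.1)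

theorem UniformlyLocallyFinite.sum_coboundary_le {V : Type*} [LinearOrder V]
    {Y : AbstractSimplicialComplex V} {j M : ℕ}
    (hM : ∀ σ : Simplex Y j, ∀ S : Finset (Simplex Y (j + 1)),
      (∀ τ ∈ S, σ.1 ⊆ τ.1) → S.card ≤ M)
    (f : L2Cochain Y j) (S : Finset (Simplex Y (j + 1))) :
    ∑ τ ∈ S, ‖coboundaryFun f τ‖ ^ (2 : ℝ≥0∞).toReal
      ≤ (Real.sqrt ((j + 2) * M) * ‖f‖) ^ (2 : ℝ≥0∞).toReal := by
  classical
  simp only [ENNReal.toReal_ofNat, Real.rpow_ofNat]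
  rw [mul_pow, Real.sq_sqrt (by positivity)]
  have h1 : ∀ τ : Simplex Y (j + 1), ‖coboundaryFun f τ‖ ^ 2
      ≤ (j + 2) * ∑ v : {v // v ∈ τ.1}, ‖f (τ.face v)‖ ^ 2 := by
    intro τ
    have h2 : ‖coboundaryFun f τ‖ ≤ ∑ v : {v // v ∈ τ.1}, ‖f (τ.face v)‖ := by
      refine (norm_sum_le _ _).trans (le_of_eq (Finset.sum_congr rfl fun v _ => ?_))
      simp
    have h3 := sq_sum_le_card_mul_sum_sq (s := (Finset.univ : Finset {v // v ∈ τ.1}))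
      (f := fun v => ‖f (τ.face v)‖)
    have hc : ((Finset.univ : Finset {v // v ∈ τ.1}).card : ℝ) = j + 2 := by
      rw [Finset.card_univ, Fintype.card_coe, τ.2.2]; push_cast; ring
    rw [hc] at h3
    exact (pow_le_pow_left₀ (norm_nonneg _) h2 2).trans h3
  let P : Finset (Σ τ : Simplex Y (j + 1), {v // v ∈ τ.1}) := S.sigma fun _ => Finset.univ
  let φ : (Σ τ : Simplex Y (j + 1), {v // v ∈ τ.1}) → Simplex Y j := fun p => p.1.face p.2
  have h4 : ∀ σ : Simplex Y j, (P.filter fun p => φ p = σ).card ≤ M := by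
    intro σ
    have hinj : Set.InjOn (fun p : (Σ τ : Simplex Y (j + 1), {v // v ∈ τ.1}) => p.1)
        (P.filter fun p => φ p = σ : Finset _) := by
      rintro ⟨τ, v⟩ hp ⟨τ', v'⟩ hp' he
      simp only [Finset.coe_filter, Set.mem_ofPred_eq] at hp hp'
      simp only at he
      subst he
      have h5 : τ.1.erase v.1 = τ.1.erase v'.1 := congrArg Subtype.val (hp.2.trans hp'.2.symm)
      have h6 : v = v' := by
        by_contra hne
        have h7 : v'.1 ∈ τ.1.erase v.1 :=
          Finset.mem_erase.2 ⟨fun h => hne (Subtype.ext h.symm), v'.2⟩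
        rw [h5] at h7
        exact absurd h7 (Finset.notMem_erase _ _)
      rw [h6]
    rw [← Finset.card_image_of_injOn hinj]
    refine hM σ _ fun τ hτ => ?_
    obtain ⟨p, hp, rfl⟩ := Finset.mem_image.1 hτ
    rw [← (Finset.mem_filter.1 hp).2]
    exact Finset.erase_subset _ _
  have h8 : ∑ τ ∈ S, ∑ v : {v // v ∈ τ.1}, ‖f (τ.face v)‖ ^ 2 ≤ M * ‖f‖ ^ 2 := by
    have e1 : ∑ τ ∈ S, ∑ v : {v // v ∈ τ.1}, ‖f (τ.face v)‖ ^ 2 = ∑ p ∈ P, ‖f (φ p)‖ ^ 2 :=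
      (Finset.sum_sigma S (fun _ => Finset.univ) fun p => ‖f (φ p)‖ ^ 2).symm
    have e2 : ∑ p ∈ P, ‖f (φ p)‖ ^ 2
        = ∑ σ ∈ P.image φ, ∑ p ∈ P.filter (fun p => φ p = σ), ‖f (φ p)‖ ^ 2 :=
      (Finset.sum_fiberwise_of_maps_to (fun p hp => Finset.mem_image_of_mem φ hp) _).symm
    rw [e1, e2]
    have e3 : ∀ σ ∈ P.image φ, ∑ p ∈ P.filter (fun p => φ p = σ), ‖f (φ p)‖ ^ 2
        ≤ M * ‖f σ‖ ^ 2 := by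
      intro σ _
      rw [Finset.sum_congr rfl (g := fun _ => ‖f σ‖ ^ 2)
        (fun p hp => by rw [(Finset.mem_filter.1 hp).2])]
      rw [Finset.sum_const, nsmul_eq_mul]
      exact mul_le_mul_of_nonneg_right (by exact_mod_cast h4 σ) (by positivity)
    refine (Finset.sum_le_sum e3).trans ?_
    rw [← Finset.mul_sum]
    refine mul_le_mul_of_nonneg_left ?_ (by positivity)
    simpa using lp.sum_rpow_le_norm_rpow (p := 2) (by simp) f (P.image φ)
  calc ∑ τ ∈ S, ‖coboundaryFun f τ‖ ^ 2
      ≤ ∑ τ ∈ S, (j + 2 : ℝ) * ∑ v : {v // v ∈ τ.1}, ‖f (τ.face v)‖ ^ 2 :=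
        Finset.sum_le_sum fun τ _ => h1 τ
    _ = (j + 2 : ℝ) * ∑ τ ∈ S, ∑ v : {v // v ∈ τ.1}, ‖f (τ.face v)‖ ^ 2 := by
        rw [Finset.mul_sum]
    _ ≤ (j + 2 : ℝ) * (M * ‖f‖ ^ 2) := mul_le_mul_of_nonneg_left h8 (by positivity)
    _ = (j + 2) * M * ‖f‖ ^ 2 := by ring

/-- The coboundary as a bounded operator on square summable cochains. -/
def coboundary {V : Type*} [LinearOrder V] {Y : AbstractSimplicialComplex V}
    (hY : UniformlyLocallyFinite Y) (j : ℕ) : L2Cochain Y j →L[ℂ] L2Cochain Y (j + 1) :=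
  LinearMap.mkContinuousOfExistsBound
    { toFun := fun f => ⟨coboundaryFun f,
        memℓp_gen' (UniformlyLocallyFinite.sum_coboundary_le (hY j).choose_spec f)⟩
      map_add' := fun f g => by
        ext τ
        change coboundaryFun (f + g : L2Cochain Y j) τ = coboundaryFun f τ + coboundaryFun g τ
        simp [coboundaryFun, mul_add, Finset.sum_add_distrib]
      map_smul' := fun c f => by
        ext τ
        change coboundaryFun (c • f : L2Cochain Y j) τ = c * coboundaryFun f τ
        simp [coboundaryFun, Finset.mul_sum, mul_left_comm] }
    ⟨Real.sqrt ((j + 2) * (hY j).choose), fun f =>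
      lp.norm_le_of_forall_sum_le (by simp) (by positivity)
        (UniformlyLocallyFinite.sum_coboundary_le (hY j).choose_spec f)⟩

theorem coboundary_apply {V : Type*} [LinearOrder V] {Y : AbstractSimplicialComplex V}
    (hY : UniformlyLocallyFinite Y) (j : ℕ) (f : L2Cochain Y j) (τ : Simplex Y (j + 1)) :
    coboundary hY j f τ = coboundaryFun f τ := rfl

/-- The combinatorial Laplacian `Δ_j = d_{j-1} d_{j-1}^* + d_j^* d_j` (with `d_{-1} = 0`). -/
def laplacian {V : Type*} [LinearOrder V] {Y : AbstractSimplicialComplex V}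
    (hY : UniformlyLocallyFinite Y) : (j : ℕ) → (L2Cochain Y j →L[ℂ] L2Cochain Y j)
  | 0 => (ContinuousLinearMap.adjoint (coboundary hY 0)).comp (coboundary hY 0)
  | j + 1 => (coboundary hY j).comp (ContinuousLinearMap.adjoint (coboundary hY j)) +
      (ContinuousLinearMap.adjoint (coboundary hY (j + 1))).comp (coboundary hY (j + 1))

/-! ### Spectral projections -/

section Spectral

variable {H : Type*} [NormedAddCommGroup H] [InnerProductSpace ℂ H] [CompleteSpace H]

/-- The subspace `ker (T - lam)⁺`, the range of the spectral projection `χ_{(-∞, lam]}(T)` of a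
bounded self-adjoint operator `T`. -/
def spectralSubspace (T : H →L[ℂ] H) (lam : ℝ) : Submodule ℂ H :=
  (cfc (fun x : ℝ => max (x - lam) 0) T).ker

instance (T : H →L[ℂ] H) (lam : ℝ) : (spectralSubspace T lam).HasOrthogonalProjection := by
  have : CompleteSpace (spectralSubspace T lam) :=
    (ContinuousLinearMap.isClosed_ker (cfc (fun x : ℝ => max (x - lam) 0) T)).completeSpace_coe
  infer_instance

/-- The spectral projection `χ_{(-∞, lam]}(T)` of a bounded self-adjoint operator `T`, which is
`χ_{[0, lam]}(T)` if `T` is positive. These projections form the right continuous resolution of the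
identity of `T`. -/
def spectralProjection (T : H →L[ℂ] H) (lam : ℝ) : H →L[ℂ] H :=
  (spectralSubspace T lam).starProjection

theorem spectralSubspace_mono (T : H →L[ℂ] H) : Monotone (spectralSubspace T) := by
  intro a b hab
  rcases hab.eq_or_lt with rfl | hlt
  · exact le_rfl
  have hpos : ∀ x : ℝ, max (x - a) (b - a) ≠ 0 := fun x =>
    (lt_of_lt_of_le (sub_pos.2 hlt) (le_max_right _ _)).ne'
  have hc : Continuous fun x : ℝ => max (x - b) 0 / max (x - a) (b - a) :=
    Continuous.div (by fun_prop) (by fun_prop) hpos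
  have key : cfc (fun x : ℝ => max (x - b) 0) T
      = cfc (fun x : ℝ => max (x - b) 0 / max (x - a) (b - a)) T *
        cfc (fun x : ℝ => max (x - a) 0) T := by
    rw [← cfc_mul _ _ T hc.continuousOn (by fun_prop)]
    refine cfc_congr fun x _ => ?_
    rcases le_total x b with h | h
    · simp [max_eq_right (sub_nonpos.2 h)]
    · have h1 : b - a ≤ x - a := by linarith
      have h2 : 0 ≤ x - a := by linarith
      have h3 := hpos x
      rw [max_eq_left h1] at h3
      simp only [max_eq_left h1, max_eq_left h2]
      rw [div_mul_cancel₀ _ h3]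
  intro x hx
  have hx' : cfc (fun x : ℝ => max (x - a) 0) T x = 0 := hx
  change cfc (fun x : ℝ => max (x - b) 0) T x = 0
  rw [key]
  change cfc _ T (cfc (fun x : ℝ => max (x - a) 0) T x) = 0
  rw [hx', map_zero]

theorem spectralSubspace_eq_iInf (T : H →L[ℂ] H) (a : ℝ) :
    spectralSubspace T a = ⨅ n : ℕ, spectralSubspace T (a + 1 / (n + 1)) := by
  refine le_antisymm (le_iInf fun n => spectralSubspace_mono T
    (by have : (0 : ℝ) < 1 / ((n : ℝ) + 1) := by positivity
        linarith)) ?_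
  intro x hx
  rw [Submodule.mem_iInf] at hx
  have ht : Filter.Tendsto (fun n : ℕ => cfc (fun x : ℝ => max (x - (a + 1 / (n + 1))) 0) T)
      Filter.atTop (𝓝 (cfc (fun x : ℝ => max (x - a) 0) T)) := by
    refine tendsto_cfc_fun ?_ (Filter.Eventually.of_forall fun n => by fun_prop)
    rw [Metric.tendstoUniformlyOn_iff]
    intro ε hε
    have h0 := tendsto_one_div_add_atTop_nhds_zero_nat (𝕜 := ℝ)
    filter_upwards [h0.eventually (gt_mem_nhds hε)] with n hn y _
    have hp : (0 : ℝ) ≤ 1 / ((n : ℝ) + 1) := by positivity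
    rw [Real.dist_eq]
    refine lt_of_le_of_lt (abs_max_sub_max_le_abs _ _ _) ?_
    rw [show y - a - (y - (a + 1 / ((n : ℝ) + 1))) = 1 / ((n : ℝ) + 1) by ring, abs_of_nonneg hp]
    exact hn
  have ht' := (ContinuousLinearMap.apply ℂ H x).continuous.tendsto _ |>.comp ht
  have hz : ∀ n : ℕ, cfc (fun x : ℝ => max (x - (a + 1 / (n + 1))) 0) T x = 0 := fun n => hx n
  have hlim : Filter.Tendsto (fun _ : ℕ => (0 : H)) Filter.atTop
      (𝓝 (cfc (fun x : ℝ => max (x - a) 0) T x)) :=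
    ht'.congr fun n => hz n
  exact tendsto_nhds_unique hlim tendsto_const_nhds

theorem inner_spectralProjection (T : H →L[ℂ] H) (a : ℝ) (x : H) :
    (inner ℂ (spectralProjection T a x) x).re = ‖spectralProjection T a x‖ ^ 2 := by
  have h := Submodule.re_inner_starProjection_eq_normSq (K := spectralSubspace T a) x
  simpa [spectralProjection] using h

theorem norm_spectralProjection_mono (T : H →L[ℂ] H) (x : H) :
    Monotone fun a : ℝ => ‖spectralProjection T a x‖ := by
  intro a b hab
  have h := Submodule.starProjection_comp_starProjection_of_le (spectralSubspace_mono T hab)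
  have h' : spectralProjection T a x = spectralProjection T a (spectralProjection T b x) :=
    (DFunLike.congr_fun h x).symm
  change ‖spectralProjection T a x‖ ≤ ‖spectralProjection T b x‖
  rw [h']
  exact Submodule.norm_starProjection_apply_le _ _

theorem inner_spectralProjection_mono (T : H →L[ℂ] H) (x : H) :
    Monotone fun a : ℝ => (inner ℂ (spectralProjection T a x) x).re := by
  intro a b hab
  simp only [inner_spectralProjection]
  exact pow_le_pow_left₀ (norm_nonneg _) (norm_spectralProjection_mono T x hab) 2

theorem tendsto_spectralProjection (T : H →L[ℂ] H) (a : ℝ) (x : H) :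
    Filter.Tendsto (fun n : ℕ => spectralProjection T (a + 1 / (n + 1)) x) Filter.atTop
      (𝓝 (spectralProjection T a x)) := by
  let U : ℕ → Submodule ℂ H := fun n => (spectralSubspace T (a + 1 / (n + 1)))ᗮ
  have hU : Monotone U := fun m n hmn => Submodule.orthogonal_le (spectralSubspace_mono T (by
    have : (1 : ℝ) / ((n : ℝ) + 1) ≤ 1 / ((m : ℝ) + 1) :=
      one_div_le_one_div_of_le (by positivity) (by exact_mod_cast Nat.succ_le_succ hmn)
    linarith))
  have h1 := Submodule.starProjection_tendsto_closure_iSup U hU x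
  have h2 : (⨆ n, U n).topologicalClosure = (spectralSubspace T a)ᗮ := by
    rw [← Submodule.orthogonal_orthogonal_eq_closure, ← Submodule.iInf_orthogonal]
    congr 1
    rw [spectralSubspace_eq_iInf]
    exact iInf_congr fun n => Submodule.orthogonal_orthogonal _
  have h3 : ∀ K : Submodule ℂ H, ∀ [K.HasOrthogonalProjection],
      K.starProjection x = x - Kᗮ.starProjection x := fun K _ => by
    rw [Submodule.starProjection_orthogonal_val]; simp
  simp only [h2] at h1
  have h4 := (tendsto_const_nhds (x := x)).sub h1
  rw [← h3] at h4
  refine h4.congr fun n => ?_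
  exact (h3 (spectralSubspace T (a + 1 / (n + 1)))).symm

theorem inner_spectralProjection_right_continuous (T : H →L[ℂ] H) (x : H) (a : ℝ) :
    ContinuousWithinAt (fun a : ℝ => (inner ℂ (spectralProjection T a x) x).re) (Set.Ici a) a := by
  rw [← continuousWithinAt_Ioi_iff_Ici]
  have hm := inner_spectralProjection_mono T x
  have h1 := hm.tendsto_nhdsGT a
  have h2 : Filter.Tendsto (fun n : ℕ => a + 1 / ((n : ℝ) + 1)) Filter.atTop (𝓝[>] a) := by
    refine tendsto_nhdsWithin_iff.2 ⟨?_, Filter.Eventually.of_forall fun n => ?_⟩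
    · simpa using (tendsto_const_nhds (x := a)).add
        (tendsto_one_div_add_atTop_nhds_zero_nat (𝕜 := ℝ))
    · have : (0 : ℝ) < 1 / ((n : ℝ) + 1) := by positivity
      exact Set.mem_Ioi.2 (by linarith)
  have h3 := h1.comp h2
  have h4 : Filter.Tendsto
      (fun n : ℕ => (inner ℂ (spectralProjection T (a + 1 / (n + 1)) x) x).re) Filter.atTop
      (𝓝 (inner ℂ (spectralProjection T a x) x).re) := by
    simp only [inner_spectralProjection]
    exact ((tendsto_spectralProjection T a x).norm).pow 2
  rw [tendsto_nhds_unique h3 h4] at h1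
  exact h1

end Spectral

/-! ### The spectral density function -/

/-- Two `j`-simplices are equivalent if they lie in the same orbit. -/
def orbitSetoid (G : Type*) {V : Type*} [Group G] [LinearOrder V] [MulAction G V]
    (Y : AbstractSimplicialComplex V) (j : ℕ) : Setoid (Simplex Y j) :=
  (MulAction.orbitRel G (Finset V)).comap Subtype.val

/-- The `j`-simplices of `Y / G`. -/
abbrev QuotientSimplex (G : Type*) {V : Type*} [Group G] [LinearOrder V] [MulAction G V]
    (Y : AbstractSimplicialComplex V) (j : ℕ) : Type _ :=
  Quotient (orbitSetoid G Y j)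

theorem FreeCocompact.finite_quotientSimplex {G V : Type*} [Group G] [LinearOrder V]
    [MulAction G V] {Y : AbstractSimplicialComplex V} (h : FreeCocompact G Y) (j : ℕ) :
    Finite (QuotientSimplex G Y j) := by
  have := h.finite_quotient.to_subtype
  refine Finite.of_injective
    (β := {O : Set (Finset V) | ∃ s ∈ Y.faces, O = MulAction.orbit G s})
    (fun c => ⟨MulAction.orbit G c.out.1, c.out.1, c.out.2.1, rfl⟩) fun c c' he => ?_
  have h1 : MulAction.orbit G c.out.1 = MulAction.orbit G c'.out.1 := congrArg Subtype.val he
  have h2 : orbitSetoid G Y j c.out c'.out :=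
    MulAction.orbitRel_apply.2 (MulAction.orbit_eq_iff.1 h1)
  rw [← Quotient.out_eq c, ← Quotient.out_eq c']
  exact Quotient.sound h2

/-- The cochain that is `1` on `σ` and `0` on the other simplices. -/
def delta {V : Type*} [LinearOrder V] {Y : AbstractSimplicialComplex V} {j : ℕ}
    (σ : Simplex Y j) : L2Cochain Y j :=
  lp.single 2 σ (1 : ℂ)

/-- The von Neumann trace `∑ ⟨A δ_σ, δ_σ⟩`, the sum over one simplex `σ` of `Y` above each
`j`-simplex of `Y / G`. For `G`-equivariant `A` it does not depend on the choice of the `σ`. -/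
def vonNeumannTrace (G : Type*) {V : Type*} [Group G] [LinearOrder V] [MulAction G V]
    (Y : AbstractSimplicialComplex V) (j : ℕ) (A : L2Cochain Y j →L[ℂ] L2Cochain Y j) : ℂ :=
  ∑ᶠ c : QuotientSimplex G Y j, inner ℂ (A (delta c.out)) (delta c.out)

theorem re_vonNeumannTrace {G V : Type*} [Group G] [LinearOrder V]
    [MulAction G V] {Y : AbstractSimplicialComplex V} (j : ℕ)
    [Fintype (QuotientSimplex G Y j)] (A : L2Cochain Y j →L[ℂ] L2Cochain Y j) :
    (vonNeumannTrace G Y j A).re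
      = ∑ c : QuotientSimplex G Y j, (inner ℂ (A (delta c.out)) (delta c.out)).re := by
  rw [vonNeumannTrace, finsum_eq_sum_of_fintype, Complex.re_sum]

/-- The spectral density function `F(lam) = Tr χ_{[0, lam]}(Δ_j)` (the trace is real). It is
monotone and right continuous, so it defines a Lebesgue–Stieltjes measure `dF`. -/
def spectralDensity {G V : Type*} [Group G] [LinearOrder V]
    [MulAction G V] {Y : AbstractSimplicialComplex V} (h : FreeCocompact G Y) (j : ℕ) :
    StieltjesFunction ℝ where
  toFun lam :=
    (vonNeumannTrace G Y j (spectralProjection (laplacian h.uniformlyLocallyFinite j) lam)).re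
  mono' := by
    have := h.finite_quotientSimplex j
    have := Fintype.ofFinite (QuotientSimplex G Y j)
    intro a b hab
    simp only [re_vonNeumannTrace]
    exact Finset.sum_le_sum fun c _ => inner_spectralProjection_mono _ _ hab
  right_continuous' := by
    have := h.finite_quotientSimplex j
    have := Fintype.ofFinite (QuotientSimplex G Y j)
    intro a
    simp only [re_vonNeumannTrace]
    exact tendsto_finsetSum _ fun c _ => inner_spectralProjection_right_continuous _ _ a

/-- `Y` is of determinant class: for every `j`, `∫_{0+}^1 log lam dF(lam) > -∞`, where `F` is the
spectral density function of `Δ_j`. As `log ≤ 0` on `(0, 1]`, the integral over `(0, 1]` is finite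
if and only if `log` is integrable there. -/
def IsDeterminantClass {G V : Type*} [Group G] [LinearOrder V]
    [MulAction G V] {Y : AbstractSimplicialComplex V} (h : FreeCocompact G Y) : Prop :=
  ∀ j : ℕ, MeasureTheory.IntegrableOn Real.log (Set.Ioc 0 1) (spectralDensity h j).measure

end

end DetClass

namespace DetClass

noncomputable section

/-! The reason is integrality. In the basis of simplices `Δ_j` has integer entries, so its
truncation to a finite set `X` of simplices is an integer Hermitian matrix. The product of the
nonzero eigenvalues of such a matrix is, up to sign, the lowest nonzero coefficient of its
characteristic polynomial, hence at least `1` in absolute value (`one_le_prod_abs_eigenvalues`). The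
eigenvalues lie in `[0, ‖Δ_j‖]`, so few of them can be small and nonzero: summed over `m`, the
numbers of eigenvalues in `(0, 2⁻ᵐ]` are bounded by a constant times `#X`
(`sum_layerCount_eigenvalues_le`).

Amenability carries this bound over to `Δ_j`. If `X` consists of the translates of a fundamental
domain by a Følner set, then for a polynomial `p` the diagonal entries of `p(Δ_j)` and of `p` of the
truncation agree away from a small boundary, because `Δ_j` has finite propagation. With polynomial
approximation, an eigenvalue bound `∑ f(λ_i) ≤ C #X` for all truncations becomes the bound `C #T`
for the trace of `f(Δ_j)`, where `T` is the set of orbits (`sum_cfcInner_le`). Only this one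
inequality is needed, not convergence of the spectral density functions of the truncations.

The step functions that count eigenvalues are not continuous, so `layerCount` replaces them by a
continuous majorant that still vanishes at `0`, which keeps the kernel from contributing. This
bounds `∑ (F(2⁻ᵐ) - F(a))` uniformly in `a > 0` and in the number of terms. Right continuity of `F`
lets `a → 0`, and the resulting dyadic bound is equivalent in strength to integrability of `log`
near `0` (`integrableOn_log_of_sum_le` is the direction used). -/

/-! ### Cut-off functions and spectral projections -/

/-- The continuous function that is `1` on `(-∞, b]`, `0` on `[2b, ∞)` and affine in between. -/
def upperCutoff (b x : ℝ) : ℝ := 1 - min 1 (max (x - b) 0 / b)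

/-- The continuous function that is `0` on `[a, ∞)` and equal to `1 - x / a` on `(-∞, a]`. -/
def lowerCutoff (a x : ℝ) : ℝ := max (1 - x / a) 0

theorem continuous_upperCutoff (b : ℝ) : Continuous (upperCutoff b) := by
  unfold upperCutoff; fun_prop

theorem continuous_lowerCutoff (a : ℝ) : Continuous (lowerCutoff a) := by
  unfold lowerCutoff; fun_prop

section Spectral

theorem re_inner_le_of_le {H : Type*} [NormedAddCommGroup H] [InnerProductSpace ℂ H]
    {A B : H →L[ℂ] H} (h : A ≤ B) (x : H) :
    (inner ℂ (A x) x).re ≤ (inner ℂ (B x) x).re := by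
  have h1 := ((ContinuousLinearMap.le_def A B).1 h).re_inner_nonneg_left x
  simp only [sub_apply, inner_sub_left, map_sub] at h1
  exact sub_nonneg.1 h1
variable {H : Type*} [NormedAddCommGroup H] [InnerProductSpace ℂ H] [CompleteSpace H]

/-- The quadratic form `⟨f(T)x, x⟩` of a function `f` of the self-adjoint operator `T`. -/
def cfcInner (f : ℝ → ℝ) (T : H →L[ℂ] H) (x : H) : ℝ := (inner ℂ (cfc f T x) x).re

theorem cfcInner_sub {f g : ℝ → ℝ} (hf : Continuous f) (hg : Continuous g) (T : H →L[ℂ] H)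
    (x : H) : cfcInner (fun t => f t - g t) T x = cfcInner f T x - cfcInner g T x := by
  rw [cfcInner, cfc_sub _ _ T hf.continuousOn hg.continuousOn, sub_apply, inner_sub_left,
    Complex.sub_re]
  rfl

theorem cfcInner_sum {ι : Type*} (s : Finset ι) {f : ι → ℝ → ℝ} (hf : ∀ i, Continuous (f i))
    (T : H →L[ℂ] H) (x : H) :
    cfcInner (fun t => ∑ i ∈ s, f i t) T x = ∑ i ∈ s, cfcInner (f i) T x := by
  have h : (fun t => ∑ i ∈ s, f i t) = ∑ i ∈ s, f i := by
    ext t; simp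
  rw [cfcInner, h, cfc_sum _ T s fun i _ => (hf i).continuousOn, sum_apply, sum_inner,
    Complex.re_sum]
  rfl

theorem spectralProjection_mem (T : H →L[ℂ] H) (a : ℝ) (x : H) :
    spectralProjection T a x ∈ spectralSubspace T a :=
  Submodule.starProjection_apply_mem _ _

theorem inner_sub_spectralProjection_left (T : H →L[ℂ] H) (a : ℝ) (x : H) {y : H}
    (hy : y ∈ spectralSubspace T a) : inner ℂ (x - spectralProjection T a x) y = 0 :=
  Submodule.inner_left_of_mem_orthogonal hy (Submodule.sub_starProjection_mem_orthogonal x)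

/-- The function `1 - upperCutoff b` is a continuous multiple of `(x - b)⁺`, with factor `1 / max b
(x - b)⁺`, so it kills the kernel of `(T - b)⁺`. -/
theorem cfc_upperCutoff_apply_of_mem {T : H →L[ℂ] H} (hT : IsSelfAdjoint T) {b : ℝ} (hb : 0 < b)
    {y : H} (hy : y ∈ spectralSubspace T b) : cfc (upperCutoff b) T y = y := by
  have hpos : ∀ x : ℝ, max b (max (x - b) 0) ≠ 0 := fun x =>
    (lt_of_lt_of_le hb (le_max_left _ _)).ne'
  have hc : Continuous fun x : ℝ => 1 / max b (max (x - b) 0) :=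
    Continuous.div (by fun_prop) (by fun_prop) hpos
  have h1 : cfc (upperCutoff b) T = 1 - cfc (fun x : ℝ => 1 / max b (max (x - b) 0)) T *
      cfc (fun x : ℝ => max (x - b) 0) T := by
    rw [← cfc_mul _ _ T hc.continuousOn (by fun_prop), ← cfc_one ℝ T,
      ← cfc_sub _ _ T (by fun_prop) (by exact (hc.mul (by fun_prop)).continuousOn)]
    refine cfc_congr fun x _ => ?_
    simp only [upperCutoff, Pi.one_apply]
    congr 1
    rcases le_total b (max (x - b) 0) with h | h
    · have h2 : 0 < max (x - b) 0 := hb.trans_le h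
      rw [max_eq_right h, min_eq_left ((one_le_div hb).2 h), one_div, inv_mul_cancel₀ h2.ne']
    · rw [max_eq_left h, min_eq_right ((div_le_one hb).2 h)]
      ring
  have h2 : cfc (fun x : ℝ => max (x - b) 0) T y = 0 := hy
  rw [h1, sub_apply, mul_apply_eq_comp, h2, map_zero, sub_zero,
    one_apply_eq_self]

/-- The cut-off operator is positive and fixes the spectral subspace, so its quadratic form splits
without cross terms into `‖y‖²` and a nonnegative contribution of `x - y`. -/
theorem inner_spectralProjection_le_upperCutoff {T : H →L[ℂ] H} (hT : IsSelfAdjoint T) {b : ℝ}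
    (hb : 0 < b) (x : H) : (inner ℂ (spectralProjection T b x) x).re
      ≤ cfcInner (upperCutoff b) T x := by
  rw [cfcInner]
  set u := cfc (upperCutoff b) T with hu
  set y := spectralProjection T b x with hy
  have huy : u y = y := cfc_upperCutoff_apply_of_mem hT hb (spectralProjection_mem T b x)
  have hz : inner ℂ (x - y) y = 0 :=
    inner_sub_spectralProjection_left T b x (spectralProjection_mem T b x)
  have hz' : inner ℂ y (x - y) = 0 := inner_eq_zero_symm.1 hz
  have hnn : 0 ≤ u := cfc_nonneg fun t _ => sub_nonneg.2 (min_le_left _ _)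
  have hsym := ((ContinuousLinearMap.nonneg_iff_isPositive u).1 hnn)
  have h1 : 0 ≤ (inner ℂ (u (x - y)) (x - y)).re := hsym.re_inner_nonneg_left _
  have h2 : inner ℂ (u (x - y)) y = 0 := by
    rw [show inner ℂ (u (x - y)) y = inner ℂ (x - y) (u y) from hsym.isSymmetric _ _, huy, hz]
  have h3 : inner ℂ (u x) x = inner ℂ y y + inner ℂ (u (x - y)) (x - y) := by
    have : x = y + (x - y) := by abel
    conv_lhs => rw [this]
    rw [map_add, huy, inner_add_left, inner_add_right, inner_add_right, hz', h2]
    ring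
  have h4 : inner ℂ y x = inner ℂ y y := by
    have : x = y + (x - y) := by abel
    conv_lhs => rw [this]
    rw [inner_add_right, hz', add_zero]
  rw [h3, h4, Complex.add_re]
  linarith

/-- Since `(x - a)⁺ * lowerCutoff a x = 0`, the cut-off operator has range in the spectral subspace
and vanishes on its orthogonal complement. Positivity of `T` is what makes it at most `1`. -/
theorem inner_lowerCutoff_le_spectralProjection {T : H →L[ℂ] H} (hT : 0 ≤ T) {a : ℝ}
    (ha : 0 < a) (x : H) :
    cfcInner (lowerCutoff a) T x ≤ (inner ℂ (spectralProjection T a x) x).re := by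
  rw [cfcInner]
  have hsa : IsSelfAdjoint T := .of_nonneg hT
  set v := cfc (lowerCutoff a) T with hv
  set y := spectralProjection T a x with hy
  have hmem : ∀ w, v w ∈ spectralSubspace T a := by
    intro w
    have h1 : cfc (fun x : ℝ => max (x - a) 0) T * v = 0 := by
      rw [hv, ← cfc_mul _ _ T (by fun_prop) (continuous_lowerCutoff a).continuousOn,
        ← cfc_zero ℝ T]
      refine cfc_congr fun x _ => ?_
      simp only [lowerCutoff, Pi.zero_apply]
      rcases le_total x a with h | h
      · rw [max_eq_right (sub_nonpos.2 h), zero_mul]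
      · rw [max_eq_right (a := 1 - x / a) (sub_nonpos.2 ((one_le_div ha).2 h)), mul_zero]
    change cfc (fun x : ℝ => max (x - a) 0) T (v w) = 0
    rw [← mul_apply_eq_comp, h1, zero_apply]
  have hnn : 0 ≤ v := cfc_nonneg fun t _ => le_max_right _ _
  have hsym := ((ContinuousLinearMap.nonneg_iff_isPositive v).1 hnn)
  have hvz : v (x - y) = 0 := by
    rw [← inner_self_eq_zero (𝕜 := ℂ)]
    rw [show inner ℂ (v (x - y)) (v (x - y)) = inner ℂ (x - y) (v (v (x - y))) from
      hsym.isSymmetric _ _]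
    exact inner_sub_spectralProjection_left T a x (hmem _)
  have hle : v ≤ 1 := by
    rw [hv, ← cfc_one ℝ T]
    refine cfc_mono (fun t ht => max_le ?_ zero_le_one)
      (continuous_lowerCutoff a).continuousOn (by fun_prop)
    have : 0 ≤ t / a := div_nonneg (spectrum_nonneg_of_nonneg hT ht) ha.le
    simpa using this
  have h1 : inner ℂ (v x) x = inner ℂ (v y) y := by
    have hx : x = y + (x - y) := by abel
    have : v x = v y := by
      conv_lhs => rw [hx]
      rw [map_add, hvz, add_zero]
    rw [this]
    conv_lhs => rw [hx]
    rw [inner_add_right, inner_eq_zero_symm.1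
      (inner_sub_spectralProjection_left T a x (hmem y)), add_zero]
  have h2 : inner ℂ y x = inner ℂ y y := by
    have hx : x = y + (x - y) := by abel
    conv_lhs => rw [hx]
    rw [inner_add_right, inner_eq_zero_symm.1 (inner_sub_spectralProjection_left T a x
      (spectralProjection_mem T a x)), add_zero]
  rw [h1, h2]
  exact re_inner_le_of_le hle y

end Spectral

/-! ### Eigenvalues of integer matrices -/

section IntegerMatrix

variable {n : Type*} [Fintype n] [DecidableEq n]

/-- Trailing coefficients are multiplicative, and that of `X - μ` is `-μ`, or `1` when `μ = 0`. The
product is therefore the absolute value of a nonzero integer. -/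
theorem one_le_prod_abs_eigenvalues {B : Matrix n n ℂ} (hB : B.IsHermitian)
    (hint : ∀ s t, ∃ m : ℤ, B s t = m) :
    1 ≤ ∏ i, if hB.eigenvalues i = 0 then 1 else |hB.eigenvalues i| := by
  choose a ha using hint
  have hBa : B = (Matrix.of a).map (Int.castRingHom ℂ) := by
    ext s t; simp [ha]
  have h2 : (Matrix.of a).charpoly.trailingCoeff ≠ 0 :=
    Polynomial.trailingCoeff_nonzero_iff_nonzero.2 (Matrix.charpoly_monic _).ne_zero
  have h1 : B.charpoly.trailingCoeff = ((Matrix.of a).charpoly.trailingCoeff : ℂ) := by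
    conv_lhs => rw [hBa]
    rw [Matrix.charpoly_map]
    -- `ℤ → ℂ` is injective, so the lowest nonzero coefficient stays in the same degree.
    have : (Polynomial.map (Int.castRingHom ℂ) (Matrix.of a).charpoly).natTrailingDegree
        = (Matrix.of a).charpoly.natTrailingDegree := by
      refine le_antisymm (Polynomial.natTrailingDegree_le_of_ne_zero ?_)
        (Polynomial.natTrailingDegree_le_of_ne_zero fun h => ?_)
      · rw [Polynomial.coeff_map]
        exact fun h => h2 (Int.cast_injective (α := ℂ) (by simpa using h))
      · have h5 : (Polynomial.map (Int.castRingHom ℂ) (Matrix.of a).charpoly).trailingCoeff = 0 := by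
          rw [Polynomial.trailingCoeff, Polynomial.coeff_map, h, map_zero]
        refine Polynomial.trailingCoeff_nonzero_iff_nonzero.2 ?_ h5
        exact ((Matrix.charpoly_monic _).map _).ne_zero
    rw [Polynomial.trailingCoeff, this, Polynomial.coeff_map]
    rfl
  have h3 : ∀ μ : ℝ, ‖(Polynomial.X - Polynomial.C (μ : ℂ)).trailingCoeff‖
      = if μ = 0 then 1 else |μ| := by
    intro μ
    split_ifs with h
    · subst h
      simp [Polynomial.trailingCoeff]
    · rw [Polynomial.trailingCoeff_eq_coeff_zero (by simpa using h)]
      simp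
  have h4 : ‖B.charpoly.trailingCoeff‖
      = ∏ i, if hB.eigenvalues i = 0 then 1 else |hB.eigenvalues i| := by
    rw [hB.charpoly_eq]
    have : ∀ s : Finset n, ‖(∏ i ∈ s, (Polynomial.X -
        Polynomial.C ((hB.eigenvalues i : ℝ) : ℂ))).trailingCoeff‖
        = ∏ i ∈ s, if hB.eigenvalues i = 0 then 1 else |hB.eigenvalues i| := by
      intro s
      induction s using Finset.induction_on with
      | empty => simp [Polynomial.trailingCoeff]
      | insert i s hi ih =>
        rw [Finset.prod_insert hi, Finset.prod_insert hi, Polynomial.trailingCoeff_mul, norm_mul,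
          ih, h3]
    exact this _
  rw [← h4, h1, Complex.norm_intCast]
  exact_mod_cast Int.one_le_abs h2

/-- The diagonal entries of the powers of a Hermitian matrix are moments of probability measures
on the spectrum, and these measures add up to the eigenvalue counting measure. -/
theorem exists_weights {B : Matrix n n ℂ} (hB : B.IsHermitian) :
    ∃ w : n → n → ℝ, (∀ s i, 0 ≤ w s i) ∧ (∀ s, ∑ i, w s i = 1) ∧ (∀ i, ∑ s, w s i = 1) ∧
      ∀ k s, ((B ^ k) s s).re = ∑ i, hB.eigenvalues i ^ k * w s i := by
  set U : Matrix n n ℂ := hB.eigenvectorUnitary.1 with hU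
  have hspec : B = U * Matrix.diagonal (fun i => (hB.eigenvalues i : ℂ)) * star U := by
    have := hB.spectral_theorem
    rw [Unitary.conjStarAlgAut_apply] at this
    exact this
  have hU1 : U * star U = 1 := Unitary.mul_star_self_of_mem hB.eigenvectorUnitary.2
  have hU2 : star U * U = 1 := Unitary.star_mul_self_of_mem hB.eigenvectorUnitary.2
  have hpow : ∀ k : ℕ, B ^ k
      = U * Matrix.diagonal (fun i => (hB.eigenvalues i : ℂ) ^ k) * star U := by
    intro k
    induction k with
    | zero => simp [hU1]
    | succ k ih =>
      calc B ^ (k + 1) = B ^ k * (U * Matrix.diagonal (fun i => (hB.eigenvalues i : ℂ)) *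
            star U) := by rw [pow_succ, ← hspec]
        _ = U * Matrix.diagonal (fun i => (hB.eigenvalues i : ℂ) ^ k) * (star U * U) *
            Matrix.diagonal (fun i => (hB.eigenvalues i : ℂ)) * star U := by
              rw [ih]; simp only [Matrix.mul_assoc]
        _ = _ := by
          rw [hU2, Matrix.mul_one, Matrix.mul_assoc U, Matrix.diagonal_mul_diagonal]
          simp only [pow_succ]
  have hns : ∀ z : ℂ, z * star z = ((Complex.normSq z : ℝ) : ℂ) := fun z => Complex.mul_conj z
  -- The squared moduli of a unitary matrix are doubly stochastic: `U U* = 1` gives the sums over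
  -- `i`, `U* U = 1` those over `s`.
  refine ⟨fun s i => Complex.normSq (U s i), fun s i => Complex.normSq_nonneg _, fun s => ?_,
    fun i => ?_, fun k s => ?_⟩
  · have := congrFun (congrFun hU1 s) s
    simp only [Matrix.mul_apply, Matrix.star_apply, hns, Matrix.one_apply_eq] at this
    exact_mod_cast this
  · have := congrFun (congrFun hU2 i) i
    simp only [Matrix.mul_apply, Matrix.star_apply, mul_comm (star _), hns,
      Matrix.one_apply_eq] at this
    exact_mod_cast this
  · rw [hpow, Matrix.mul_apply, Complex.re_sum]
    refine Finset.sum_congr rfl fun i _ => ?_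
    rw [Matrix.mul_diagonal, Matrix.star_apply, mul_right_comm, hns, ← Complex.ofReal_pow,
      ← Complex.ofReal_mul, Complex.ofReal_re, mul_comm]

open scoped ComplexOrder in
/-- The eigenvalues of a Hermitian matrix `B` are at most `K` if `B ≤ K`. -/
theorem eigenvalues_le_of_posSemidef {B : Matrix n n ℂ} (hB : B.IsHermitian) {K : ℝ}
    (hK : ((K : ℂ) • (1 : Matrix n n ℂ) - B).PosSemidef) (i : n) : hB.eigenvalues i ≤ K := by
  have h1 := hK.re_dotProduct_nonneg (hB.eigenvectorBasis i)
  rw [Matrix.sub_mulVec, hB.mulVec_eigenvectorBasis] at h1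
  have h2 : dotProduct (star ⇑(hB.eigenvectorBasis i)) ⇑(hB.eigenvectorBasis i) = (1 : ℂ) := by
    have := (hB.eigenvectorBasis).orthonormal.1 i
    rw [dotProduct_comm, ← EuclideanSpace.inner_eq_star_dotProduct, inner_self_eq_norm_sq_to_K,
      this]
    simp
  rw [Matrix.smul_mulVec, Matrix.one_mulVec, dotProduct_sub, dotProduct_smul, dotProduct_smul,
    h2] at h1
  simpa using h1

end IntegerMatrix

/-! ### Følner sets -/

/-- An amenable group has finite subsets that are almost invariant under right translation. -/
theorem IsAmenable.exists_right_almost_invariant {G : Type*} [Group G] [DecidableEq G]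
    (hG : IsAmenable G) (K : Finset G) {ε : ℝ} (hε : 0 < ε) :
    ∃ Λ : Finset G, Λ.Nonempty ∧
      ((Λ.filter fun g => ∃ h ∈ K, g * h ∉ Λ).card : ℝ) ≤ ε * Λ.card := by
  -- The errors of all `h ∈ K` will be added up; the `+ 1` covers empty `K`. Inverting `Λ` then
  -- turns left translation into right translation.
  obtain ⟨Λ, hfin, hne, hΛ⟩ := hG K (ε / (K.card + 1)) K.finite_toSet (by positivity)
  lift Λ to Finset G using hfin
  have hcard : Λ⁻¹.card = Λ.card := Finset.card_inv Λ
  refine ⟨Λ⁻¹, Finset.inv_nonempty_iff.2 (by simpa using hne), ?_⟩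
  have h1 : ((Λ⁻¹).filter fun g => ∃ h ∈ K, g * h ∉ Λ⁻¹)
      ⊆ K.biUnion fun h => ((h • Λ) ∆ Λ)⁻¹ := by
    intro g hg
    obtain ⟨hg1, h, hK, hg2⟩ := Finset.mem_filter.1 hg
    refine Finset.mem_biUnion.2 ⟨h, hK, ?_⟩
    rw [Finset.mem_inv', Finset.mem_symmDiff]
    refine Or.inr ⟨Finset.mem_inv'.1 hg1, fun hmem => hg2 ?_⟩
    rw [Finset.mem_inv', mul_inv_rev, ← smul_eq_mul]
    exact Finset.inv_smul_mem_iff.2 hmem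
  have h2 : ∀ h ∈ K, ((((h • Λ) ∆ Λ)⁻¹).card : ℝ) ≤ ε / (K.card + 1) * Λ.card := by
    intro h hK
    have := hΛ h hK
    rw [Finset.card_inv]
    rwa [← Finset.coe_smul_finset, ← Finset.coe_symmDiff, Set.ncard_coe_finset,
      Set.ncard_coe_finset] at this
  calc ((((Λ⁻¹).filter fun g => ∃ h ∈ K, g * h ∉ Λ⁻¹).card : ℕ) : ℝ)
      ≤ ((K.biUnion fun h => ((h • Λ) ∆ Λ)⁻¹).card : ℝ) := by
        exact_mod_cast Finset.card_le_card h1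
    _ ≤ ∑ h ∈ K, ((((h • Λ) ∆ Λ)⁻¹).card : ℝ) := by exact_mod_cast Finset.card_biUnion_le
    _ ≤ ∑ _h ∈ K, ε / (K.card + 1) * Λ.card := Finset.sum_le_sum h2
    _ = (K.card / (K.card + 1)) * (ε * Λ.card) := by
        rw [Finset.sum_const, nsmul_eq_mul]; ring
    _ ≤ 1 * (ε * Λ.card) := by
        refine mul_le_mul_of_nonneg_right ?_ (by positivity)
        rw [div_le_one (by positivity)]
        linarith
    _ = ε * (Λ⁻¹).card := by rw [one_mul, hcard]

/-! ### Integral operators of finite propagation on `ℓ²` -/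

section LocallyIntegral

variable {S S' S'' : Type*} [DecidableEq S]

theorem lp_apply_eq_tsum (A : lp (fun _ : S => ℂ) 2 →L[ℂ] lp (fun _ : S' => ℂ) 2)
    (f : lp (fun _ : S => ℂ) 2) (s : S') :
    A f s = ∑' r, A (lp.single 2 r (1 : ℂ)) s * f r := by
  have h1 := lp.hasSum_single (E := fun _ : S => ℂ) (p := 2) (by simp) f
  have h2 := (lp.evalCLM ℂ (fun _ : S' => ℂ) 2 s).hasSum (A.hasSum h1)
  refine (h2.tsum_eq.symm.trans (tsum_congr fun r => ?_))
  have h3 : lp.single 2 r (f r) = f r • (lp.single 2 r (1 : ℂ) : lp (fun _ : S => ℂ) 2) := by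
    rw [← lp.single_smul, smul_eq_mul, mul_one]
  change A (lp.single 2 r (f r)) s = _
  rw [h3, map_smul, mul_comm]
  rfl

theorem lp_apply_adjoint [DecidableEq S']
    (A : lp (fun _ : S => ℂ) 2 →L[ℂ] lp (fun _ : S' => ℂ) 2) (s : S') (r : S) : ContinuousLinearMap.adjoint A (lp.single 2 s (1 : ℂ)) r
      = star (A (lp.single 2 r (1 : ℂ)) s) := by
  have h := ContinuousLinearMap.adjoint_inner_right A
    (lp.single 2 r (1 : ℂ) : lp (fun _ : S => ℂ) 2) (lp.single 2 s (1 : ℂ))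
  rw [lp.inner_single_left, lp.inner_single_right] at h
  simpa using h

/-- A bounded operator `ℓ²(S) → ℓ²(S')` whose matrix has integral coefficients and finitely many
nonzero coefficients in each row and column, and which commutes with the action of `G` up to the
signs `e` and `e'`. -/
structure IsLocallyIntegral {G : Type*} [Group G] [MulAction G S] [MulAction G S']
    (e : G → S → ℂ) (e' : G → S' → ℂ)
    (A : lp (fun _ : S => ℂ) 2 →L[ℂ] lp (fun _ : S' => ℂ) 2) : Prop where
  finite_col : ∀ s, {r | A (lp.single 2 s (1 : ℂ)) r ≠ 0}.Finite
  finite_row : ∀ r, {s | A (lp.single 2 s (1 : ℂ)) r ≠ 0}.Finite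
  integral : ∀ s r, ∃ m : ℤ, A (lp.single 2 s (1 : ℂ)) r = m
  equivariant : ∀ g s r, A (lp.single 2 (g • s) (1 : ℂ)) (g • r)
    = e g s * e' g r * A (lp.single 2 s (1 : ℂ)) r

namespace IsLocallyIntegral

variable {G : Type*} [Group G] [MulAction G S] [MulAction G S'] [MulAction G S'']
  {e : G → S → ℂ} {e' : G → S' → ℂ} {e'' : G → S'' → ℂ}

theorem adjoint [DecidableEq S'] {A : lp (fun _ : S => ℂ) 2 →L[ℂ] lp (fun _ : S' => ℂ) 2}
    (hA : IsLocallyIntegral e e' A) (he : ∀ g s, star (e g s) = e g s)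
    (he' : ∀ g s, star (e' g s) = e' g s) :
    IsLocallyIntegral e' e (ContinuousLinearMap.adjoint A) where
  finite_col s := by simpa only [lp_apply_adjoint, star_ne_zero] using hA.finite_row s
  finite_row r := by simpa only [lp_apply_adjoint, star_ne_zero] using hA.finite_col r
  integral s r := by
    obtain ⟨m, hm⟩ := hA.integral r s
    exact ⟨m, by rw [lp_apply_adjoint, hm]; simp⟩
  equivariant g s r := by
    rw [lp_apply_adjoint, lp_apply_adjoint, hA.equivariant, star_mul', star_mul', he, he',
      mul_comm (e g r)]

theorem add {A B : lp (fun _ : S => ℂ) 2 →L[ℂ] lp (fun _ : S' => ℂ) 2}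
    (hA : IsLocallyIntegral e e' A) (hB : IsLocallyIntegral e e' B) :
    IsLocallyIntegral e e' (A + B) := by
  have h : ∀ s r, (A + B) (lp.single 2 s (1 : ℂ)) r
      = A (lp.single 2 s (1 : ℂ)) r + B (lp.single 2 s (1 : ℂ)) r := fun _ _ => rfl
  have hne : ∀ s r, (A + B) (lp.single 2 s (1 : ℂ)) r ≠ 0 →
      A (lp.single 2 s (1 : ℂ)) r ≠ 0 ∨ B (lp.single 2 s (1 : ℂ)) r ≠ 0 := by
    intro s r hr
    by_contra! hcon
    exact hr (by rw [h, hcon.1, hcon.2, add_zero])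
  refine ⟨fun s => ((hA.finite_col s).union (hB.finite_col s)).subset fun r => hne s r,
    fun r => ((hA.finite_row r).union (hB.finite_row r)).subset fun s => hne s r,
    fun s r => ?_, fun g s r => ?_⟩
  · obtain ⟨m, hm⟩ := hA.integral s r
    obtain ⟨m', hm'⟩ := hB.integral s r
    exact ⟨m + m', by rw [h, hm, hm']; push_cast; rfl⟩
  · rw [h, h, hA.equivariant, hB.equivariant, mul_add]

/-- Each entry of the product is a finite sum because the columns of `B` are finite. The
intermediate sign `e'` occurs twice and cancels. -/
theorem comp [DecidableEq S'] {A : lp (fun _ : S' => ℂ) 2 →L[ℂ] lp (fun _ : S'' => ℂ) 2}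
    {B : lp (fun _ : S => ℂ) 2 →L[ℂ] lp (fun _ : S' => ℂ) 2}
    (hA : IsLocallyIntegral e' e'' A) (hB : IsLocallyIntegral e e' B)
    (he' : ∀ g s, e' g s * e' g s = 1) : IsLocallyIntegral e e'' (A.comp B) := by
  have h : ∀ s r, A.comp B (lp.single 2 s (1 : ℂ)) r
      = ∑' q, A (lp.single 2 q (1 : ℂ)) r * B (lp.single 2 s (1 : ℂ)) q :=
    fun s r => lp_apply_eq_tsum A _ r
  have hne : ∀ s r, A.comp B (lp.single 2 s (1 : ℂ)) r ≠ 0 →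
      ∃ q, A (lp.single 2 q (1 : ℂ)) r ≠ 0 ∧ B (lp.single 2 s (1 : ℂ)) q ≠ 0 := by
    intro s r hr
    by_contra! hcon
    refine hr ((h s r).trans ((tsum_congr fun q => ?_).trans tsum_zero))
    by_cases hq : A (lp.single 2 q (1 : ℂ)) r = 0
    · rw [hq, zero_mul]
    · rw [hcon q hq, mul_zero]
  refine ⟨fun s => ((hB.finite_col s).biUnion fun q _ => hA.finite_col q).subset fun r hr => ?_,
    fun r => ((hA.finite_row r).biUnion fun q _ => hB.finite_row q).subset fun s hs => ?_,
    fun s r => ?_, fun g s r => ?_⟩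
  · obtain ⟨q, hq1, hq2⟩ := hne s r hr
    exact Set.mem_biUnion hq2 hq1
  · obtain ⟨q, hq1, hq2⟩ := hne s r hs
    exact Set.mem_biUnion hq1 hq2
  · choose m hm using hA.integral
    choose m' hm' using hB.integral
    refine ⟨∑ q ∈ (hB.finite_col s).toFinset, m q r * m' s q, ?_⟩
    rw [h, tsum_eq_sum (s := (hB.finite_col s).toFinset) fun q hq => ?_]
    · push_cast
      exact Finset.sum_congr rfl fun q _ => by rw [hm, hm']
    · rw [Set.Finite.mem_toFinset] at hq
      rw [not_not.1 hq, mul_zero]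
  -- Reindex the intermediate sum by `q ↦ g • q`.
  · rw [h, h, ← tsum_mul_left, ← (MulAction.toPerm g).tsum_eq]
    refine tsum_congr fun q => ?_
    rw [MulAction.toPerm_apply, hA.equivariant, hB.equivariant]
    linear_combination (e g s * e'' g r * A (lp.single 2 q (1 : ℂ)) r *
      B (lp.single 2 s (1 : ℂ)) q) * he' g q

theorem pow {A : lp (fun _ : S => ℂ) 2 →L[ℂ] lp (fun _ : S => ℂ) 2}
    (hA : IsLocallyIntegral e e A) (he : ∀ g s, e g s * e g s = 1) (k : ℕ) :
    IsLocallyIntegral e e (A ^ k) := by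
  induction k with
  | zero =>
    have h : ∀ s r, (A ^ 0) (lp.single 2 s (1 : ℂ)) r = if r = s then 1 else 0 := by
      intro s r
      rcases eq_or_ne r s with rfl | hne
      · simp
      · simp [hne]
    simp only [pow_zero] at h ⊢
    refine ⟨fun s => (Set.finite_singleton s).subset fun r hr => ?_,
      fun r => (Set.finite_singleton r).subset fun s hs => ?_, fun s r => ?_, fun g s r => ?_⟩
    · by_contra hne
      exact hr (by rw [h, if_neg (show r ≠ s from hne)])
    · by_contra hne
      exact hs (by rw [h, if_neg (show r ≠ s from fun h => hne h.symm)])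
    · exact ⟨if r = s then 1 else 0, by rw [h]; split_ifs <;> simp⟩
    · rcases eq_or_ne r s with rfl | hne
      · rw [h, h, if_pos rfl, if_pos rfl, he, one_mul]
      · rw [h, h, if_neg hne, if_neg fun h => hne (MulAction.injective g h), mul_zero]
  | succ k ih =>
    rw [pow_succ']
    exact hA.comp ih he

end IsLocallyIntegral

end LocallyIntegral

/-! ### Finite truncations of operators on `ℓ²` -/

theorem exists_eq_star_mul_self_of_nonneg {H : Type*} [NormedAddCommGroup H]
    [InnerProductSpace ℂ H] [CompleteSpace H] {A : H →L[ℂ] H} (hA : 0 ≤ A) :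
    ∃ B : H →L[ℂ] H, A = star B * B :=
  CStarAlgebra.nonneg_iff_eq_star_mul_self.1 hA

theorem norm_smul_one_sub_nonneg {H : Type*} [NormedAddCommGroup H]
    [InnerProductSpace ℂ H] [CompleteSpace H] {A : H →L[ℂ] H} (hA : 0 ≤ A) :
    0 ≤ (‖A‖ : ℂ) • 1 - A := by
  have h1 := sub_nonneg.2 (IsSelfAdjoint.le_algebraMap_norm_self (.of_nonneg hA : IsSelfAdjoint A))
  convert h1 using 2
  ext x
  rw [Algebra.algebraMap_eq_smul_one]
  simp

section Truncation

variable {S : Type*} [DecidableEq S]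

/-- The matrix of the operator `A` truncated to a finite set of basis vectors. -/
def truncation (A : lp (fun _ : S => ℂ) 2 →L[ℂ] lp (fun _ : S => ℂ) 2) (X : Finset S) :
    Matrix X X ℂ :=
  Matrix.of fun s t => A (lp.single 2 t.1 (1 : ℂ)) s.1

-- Writing `A = B* B` exhibits the truncation as the Gram matrix of the vectors `B δ_s`.
open scoped ComplexOrder in
theorem posSemidef_truncation {A : lp (fun _ : S => ℂ) 2 →L[ℂ] lp (fun _ : S => ℂ) 2}
    (hA : 0 ≤ A) (X : Finset S) : (truncation A X).PosSemidef := by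
  obtain ⟨B, rfl⟩ := exists_eq_star_mul_self_of_nonneg hA
  have h1 : truncation (star B * B) X = Matrix.gram ℂ fun s : X =>
      B (lp.single 2 s.1 (1 : ℂ) : lp (fun _ : S => ℂ) 2) := by
    ext s t
    rw [Matrix.gram_apply, ← ContinuousLinearMap.adjoint_inner_right, lp.inner_single_left]
    simp [truncation, ContinuousLinearMap.star_eq_adjoint]
  rw [h1]
  exact Matrix.posSemidef_gram ℂ _

-- Truncation preserves positivity; apply this to `A` and to `‖A‖ - A`.
open scoped ComplexOrder in
theorem eigenvalues_truncation_mem {A : lp (fun _ : S => ℂ) 2 →L[ℂ] lp (fun _ : S => ℂ) 2}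
    (hA : 0 ≤ A) (X : Finset S) (hX : (truncation A X).IsHermitian) (i : X) :
    hX.eigenvalues i ∈ Set.Icc 0 ‖A‖ := by
  refine ⟨(posSemidef_truncation hA X).eigenvalues_nonneg i, ?_⟩
  refine eigenvalues_le_of_posSemidef hX ?_ i
  have h1 : truncation ((‖A‖ : ℂ) • 1 - A) X
      = (‖A‖ : ℂ) • (1 : Matrix X X ℂ) - truncation A X := by
    ext s t
    have h2 : truncation ((‖A‖ : ℂ) • 1 - A) X s t = (‖A‖ : ℂ) *
        (lp.single 2 t.1 (1 : ℂ) : lp (fun _ : S => ℂ) 2) s.1 - truncation A X s t := rfl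
    rw [h2]
    rcases eq_or_ne s t with rfl | hne
    · simp
    · simp [hne]
  rw [← h1]
  exact posSemidef_truncation (norm_smul_one_sub_nonneg hA) X

/-- Matrix multiplication inside `X` loses nothing as long as the supports of all intermediate
vectors `A ^ j δ_t` stay in `X`. -/
theorem truncation_pow_apply {A : lp (fun _ : S => ℂ) 2 →L[ℂ] lp (fun _ : S => ℂ) 2}
    {X : Finset S} (t : X) (k : ℕ)
    (h : ∀ j ≤ k, ∀ r, (A ^ j) (lp.single 2 t.1 (1 : ℂ)) r ≠ 0 → r ∈ X) (s : X) :
    (truncation A X ^ k) s t = (A ^ k) (lp.single 2 t.1 (1 : ℂ)) s.1 := by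
  induction k generalizing s with
  | zero =>
    rcases eq_or_ne s t with rfl | hne
    · simp
    · simp [hne, Subtype.coe_ne_coe.2 hne]
  | succ k ih =>
    rw [pow_succ', pow_succ', Matrix.mul_apply, mul_apply_eq_comp, lp_apply_eq_tsum,
      tsum_eq_sum (s := X) fun r hr => ?_, ← Finset.sum_coe_sort X]
    · refine Finset.sum_congr rfl fun r _ => ?_
      rw [ih (fun j hj => h j (hj.trans k.le_succ))]
      rfl
    · by_contra hne
      exact hr (h k k.le_succ r (right_ne_zero_of_mul hne))

end Truncation

/-! ### Approximation of the von Neumann trace by truncations -/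

theorem re_aeval_inner {H : Type*} [NormedAddCommGroup H] [InnerProductSpace ℂ H]
    (A : H →L[ℂ] H) (p : Polynomial ℝ) (x : H) :
    (inner ℂ (Polynomial.aeval A p x) x).re
      = p.sum fun k a => a * (inner ℂ ((A ^ k) x) x).re := by
  rw [Polynomial.aeval_eq_sum_range, Polynomial.sum_over_range _ (by simp)]
  simp only [sum_apply, sum_inner, Complex.re_sum]
  refine Finset.sum_congr rfl fun k _ => ?_
  rw [smul_apply, ← Complex.coe_smul, inner_smul_left, Complex.conj_ofReal, Complex.re_ofReal_mul]

theorem cfcInner_le_sum_add {H : Type*} [NormedAddCommGroup H] [InnerProductSpace ℂ H]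
    [CompleteSpace H] {A : H →L[ℂ] H} (hA : 0 ≤ A) {f : ℝ → ℝ} (hf : Continuous f)
    {p : Polynomial ℝ} {η : ℝ} (hp : ∀ x ∈ Set.Icc 0 ‖A‖, |p.eval x - f x| < η)
    {x : H} (hx : ‖x‖ = 1) :
    cfcInner f A x ≤ (p.sum fun k a => a * (inner ℂ ((A ^ k) x) x).re) + η := by
  rw [cfcInner, ← re_aeval_inner]
  have hsa : IsSelfAdjoint A := .of_nonneg hA
  have h1 : cfc f A ≤ Polynomial.aeval A (p + Polynomial.C η) := by
    rw [← cfc_polynomial _ A hsa]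
    refine cfc_mono (fun t ht => ?_) hf.continuousOn (by fun_prop)
    have h2 : t ∈ Set.Icc 0 ‖A‖ := by
      refine ⟨spectrum_nonneg_of_nonneg hA ht, (le_abs_self t).trans ?_⟩
      -- The norm bound on the spectrum needs a nonzero algebra; in the zero algebra the spectrum is
      -- empty.
      have : Nontrivial (H →L[ℂ] H) := by
        by_contra hcon
        rw [not_nontrivial_iff_subsingleton] at hcon
        rw [spectrum.of_subsingleton] at ht
        exact ht
      exact spectrum.norm_le_norm_of_mem ht
    have h3 := (abs_lt.1 (hp t h2)).1
    simp only [Polynomial.eval_add, Polynomial.eval_C]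
    linarith
  have h2 := re_inner_le_of_le h1 x
  have h3 : Polynomial.aeval A (p + Polynomial.C η) x
      = Polynomial.aeval A p x + (η : ℂ) • x := by
    rw [map_add, add_apply, Polynomial.aeval_C, Algebra.algebraMap_eq_smul_one]
    simp
  rw [h3, inner_add_left, inner_smul_left, inner_self_eq_norm_sq_to_K, hx] at h2
  simpa using h2

section Approximation

variable {S : Type*} [DecidableEq S]

/-- Replace `f` by a polynomial `p`, and `p(A)` by `p` of the truncation to `X = Λ • c(T)` with `Λ`
a Følner set. The diagonal entries agree except on a boundary of small proportion, where they are
controlled by the constant `D`. -/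
theorem sum_cfcInner_le {G T : Type*} [Group G] [MulAction G S] [Fintype T] (hG : IsAmenable G)
    {c : T → S} (hc : Function.Bijective fun p : G × T => p.1 • c p.2)
    {A : lp (fun _ : S => ℂ) 2 →L[ℂ] lp (fun _ : S => ℂ) 2} (hA : 0 ≤ A)
    {e : G → S → ℂ} (he : ∀ g s, e g s * e g s = 1) (hloc : IsLocallyIntegral e e A)
    {f : ℝ → ℝ} (hf : Continuous f) {C : ℝ}
    (hC : ∀ (X : Finset S) (hX : (truncation A X).IsHermitian),
      ∑ i, f (hX.eigenvalues i) ≤ C * X.card) :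
    ∑ t, cfcInner f A (lp.single 2 (c t) (1 : ℂ)) ≤ C * Fintype.card T := by
  classical
  set N : ℝ := (Fintype.card T : ℝ) with hN
  have hN0 : 0 ≤ N := Nat.cast_nonneg _
  refine le_of_forall_pos_le_add fun δ hδ => ?_
  -- The approximation is used twice, for `A` and for the truncation, and the boundary is a third
  -- error; each costs at most `δ / 4`.
  obtain ⟨p, hp⟩ := exists_polynomial_near_of_continuousOn 0 ‖A‖ f hf.continuousOn
    (δ / (4 * (N + 1))) (by positivity)
  set η := δ / (4 * (N + 1)) with hη
  have hη0 : 0 < η := by positivity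
  -- diagonal entries of `p(A)`
  set q : S → ℝ := fun s => p.sum fun k a => a * ((A ^ k) (lp.single 2 s (1 : ℂ)) s).re with hq
  have hqinner : ∀ s, cfcInner f A (lp.single 2 s (1 : ℂ)) ≤ q s + η := by
    intro s
    refine (cfcInner_le_sum_add hA hf hp (by simp [lp.norm_single])).trans_eq ?_
    simp [hq, lp.inner_single_right]
  have hqsmul : ∀ (g : G) (s : S), q (g • s) = q s := by
    intro g s
    simp only [hq, (hloc.pow he _).equivariant, he, one_mul]
  -- a bound for the diagonal entries of `p(A)` and of `p` of the truncations
  obtain ⟨D1, hD1⟩ : ∃ D, ∀ x ∈ Set.Icc 0 ‖A‖, ‖p.eval x‖ ≤ D :=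
    isCompact_Icc.exists_bound_of_continuousOn p.continuous.continuousOn
  set D : ℝ := |D1| + ∑ t, |q (c t)| with hD
  have hD0 : 0 ≤ D := by positivity
  have hqD : ∀ s, q s ≤ ∑ t, |q (c t)| := by
    intro s
    obtain ⟨⟨g, t⟩, rfl⟩ := hc.2 s
    simp only [hqsmul]
    exact (le_abs_self _).trans
      (Finset.single_le_sum (f := fun t => |q (c t)|) (fun _ _ => abs_nonneg _) (Finset.mem_univ t))
  -- the finite set of group elements that bounds the propagation of `p(A)`
  obtain ⟨K, hK⟩ : ∃ K : Finset G, ∀ j ≤ p.natDegree, ∀ t r,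
      (A ^ j) (lp.single 2 (c t) (1 : ℂ)) r ≠ 0 → ∃ h ∈ K, ∃ t', r = h • c t' := by
    have h1 : (⋃ j ∈ Finset.range (p.natDegree + 1), ⋃ t,
        {r | (A ^ j) (lp.single 2 (c t) (1 : ℂ)) r ≠ 0}).Finite :=
      (Finset.finite_toSet _).biUnion fun j _ =>
        Set.finite_iUnion fun t => (hloc.pow he j).finite_col (c t)
    refine ⟨h1.toFinset.image fun r => ((Equiv.ofBijective _ hc).symm r).1,
      fun j hj t r hr => ⟨_, Finset.mem_image_of_mem _ (h1.mem_toFinset.2 ?_),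
        ((Equiv.ofBijective _ hc).symm r).2, ((Equiv.ofBijective _ hc).apply_symm_apply r).symm⟩⟩
    simp only [Set.mem_iUnion]
    exact ⟨j, Finset.mem_range.2 (Nat.lt_succ_of_le hj), t, hr⟩
  obtain ⟨Λ, hΛne, hΛ⟩ := hG.exists_right_almost_invariant K (ε := δ / (4 * (N + 1) * (D + 1)))
    (by positivity)
  have hΛ0 : (0 : ℝ) < Λ.card := by exact_mod_cast hΛne.card_pos
  set X : Finset S := (Λ ×ˢ Finset.univ).map ⟨_, hc.1⟩ with hX
  have hXsum : ∀ u : S → ℝ, ∑ s : X, u s.1 = ∑ g ∈ Λ, ∑ t, u (g • c t) := by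
    intro u
    rw [Finset.sum_coe_sort X u, hX, Finset.sum_map, Finset.sum_product]
    rfl
  have hXcard : (X.card : ℝ) = Λ.card * N := by
    rw [hX, Finset.card_map, Finset.card_product, Finset.card_univ]
    push_cast; rfl
  have hXh : (truncation A X).IsHermitian := (posSemidef_truncation hA X).1
  obtain ⟨w, hw0, hw1, hw2, hw⟩ := exists_weights hXh
  -- `m s` is the diagonal entry of `p` of the truncation. The column sums of `w` give its trace
  -- (`hmsum`); the row sums make each entry an average of values of `p` (`hmD`).
  set m : X → ℝ := fun s => ∑ i, p.eval (hXh.eigenvalues i) * w s i with hm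
  have hmsum : ∑ s, m s ≤ (C + η) * X.card := by
    have h1 : ∑ s, m s = ∑ i, p.eval (hXh.eigenvalues i) := by
      simp only [hm]
      rw [Finset.sum_comm]
      simp only [← Finset.mul_sum, hw2, mul_one]
    have h2 : ∑ i, p.eval (hXh.eigenvalues i) ≤ ∑ i, (f (hXh.eigenvalues i) + η) := by
      refine Finset.sum_le_sum fun i _ => ?_
      have := (abs_lt.1 (hp _ (eigenvalues_truncation_mem hA X hXh i))).2
      linarith
    rw [h1]
    refine h2.trans ?_
    rw [Finset.sum_add_distrib, Finset.sum_const, Finset.card_univ, Fintype.card_coe,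
      nsmul_eq_mul]
    linarith [hC X hXh]
  have hmD : ∀ s, -|D1| ≤ m s := by
    intro s
    have h1 : ∑ i, -|D1| * w s i ≤ m s := by
      refine Finset.sum_le_sum fun i _ => mul_le_mul_of_nonneg_right ?_ (hw0 s i)
      have h2 := hD1 _ (eigenvalues_truncation_mem hA X hXh i)
      have h3 := neg_abs_le (p.eval (hXh.eigenvalues i))
      rw [Real.norm_eq_abs] at h2
      linarith [le_abs_self D1]
    rwa [← Finset.mul_sum, hw1, mul_one] at h1
  -- At interior points: by equivariance `A ^ j` moves `g • c t` only to simplices `(g * h) • c t'`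
  -- with `h ∈ K`, so right translates are the ones that must stay in `Λ`.
  have hgood : ∀ g ∈ Λ, (∀ h ∈ K, g * h ∈ Λ) → ∀ t, ∀ hs : g • c t ∈ X,
      q (g • c t) = m ⟨g • c t, hs⟩ := by
    intro g hg hgK t hs
    have h1 : ∀ j ≤ p.natDegree, ∀ r, (A ^ j) (lp.single 2 (g • c t) (1 : ℂ)) r ≠ 0 → r ∈ X := by
      intro j hj r hr
      rw [← smul_inv_smul g r, (hloc.pow he _).equivariant] at hr
      obtain ⟨h, hhK, t', hr'⟩ := hK j hj t _ (right_ne_zero_of_mul hr)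
      rw [inv_smul_eq_iff, ← mul_smul] at hr'
      rw [hX, Finset.mem_map]
      exact ⟨(g * h, t'), by simp [hgK h hhK], hr'.symm⟩
    simp only [hq, hm]
    rw [Polynomial.sum_over_range _ (by simp)]
    simp only [Polynomial.eval_eq_sum_range, Finset.sum_mul]
    rw [Finset.sum_comm]
    refine Finset.sum_congr rfl fun k hk => ?_
    rw [← truncation_pow_apply ⟨g • c t, hs⟩ k
      (fun j hj => h1 j (hj.trans (Nat.lt_succ_iff.1 (Finset.mem_range.1 hk)))) ⟨g • c t, hs⟩, hw,
      Finset.mul_sum]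
    exact Finset.sum_congr rfl fun i _ => (mul_assoc _ _ _).symm
  set bad : Finset G := Λ.filter fun g => ∃ h ∈ K, g * h ∉ Λ with hbad
  have hdiff : ∀ s : X, q s.1 ≤ m s + if ((Equiv.ofBijective _ hc).symm s.1).1 ∈ bad then D
      else 0 := by
    rintro ⟨s, hs⟩
    obtain ⟨⟨g, t⟩, hgt, rfl⟩ := Finset.mem_map.1 hs
    have hg : g ∈ Λ := (Finset.mem_product.1 hgt).1
    have h1 : (Equiv.ofBijective _ hc).symm (g • c t) = (g, t) :=
      (Equiv.ofBijective _ hc).symm_apply_apply (g, t)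
    change q (g • c t) ≤ m ⟨g • c t, hs⟩ +
      if ((Equiv.ofBijective _ hc).symm (g • c t)).1 ∈ bad then D else 0
    rw [h1]
    split_ifs with hb
    · have := hmD ⟨g • c t, hs⟩
      have := hqD (g • c t)
      linarith
    · rw [add_zero]
      refine (hgood g hg (fun h hh => ?_) t hs).le
      by_contra hcon
      exact hb (Finset.mem_filter.2 ⟨hg, h, hh, hcon⟩)
  have hbadsum : ∑ s : X, (if ((Equiv.ofBijective _ hc).symm s.1).1 ∈ bad then D else 0)
      = bad.card * N * D := by
    rw [hXsum fun s => if ((Equiv.ofBijective _ hc).symm s).1 ∈ bad then D else 0]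
    have h1 : ∀ g t, (Equiv.ofBijective _ hc).symm (g • c t) = (g, t) :=
      fun g t => (Equiv.ofBijective _ hc).symm_apply_apply (g, t)
    simp only [h1, Finset.sum_const, Finset.card_univ, nsmul_eq_mul]
    rw [← Finset.mul_sum, ← Finset.sum_filter, Finset.sum_const, nsmul_eq_mul,
      Finset.filter_mem_eq_inter, Finset.inter_eq_right.2 (Finset.filter_subset _ _)]
    ring
  have hqsum : ∑ s : X, q s.1 = Λ.card * ∑ t, q (c t) := by
    rw [hXsum q]
    simp only [hqsmul, Finset.sum_const, nsmul_eq_mul]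
  -- `q` is invariant, so its sum over `X` is `#Λ` times the sum over the fundamental domain;
  -- dividing by `#Λ` leaves a multiple of the Følner ratio as boundary error.
  have hmain : Λ.card * ∑ t, q (c t)
      ≤ Λ.card * ((C + η) * N + δ / (4 * (N + 1) * (D + 1)) * N * D) := by
    calc Λ.card * ∑ t, q (c t) = ∑ s : X, q s.1 := hqsum.symm
      _ ≤ ∑ s : X, (m s + if ((Equiv.ofBijective _ hc).symm s.1).1 ∈ bad then D else 0) :=
        Finset.sum_le_sum fun s _ => hdiff s
      _ ≤ (C + η) * X.card + bad.card * N * D := by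
        rw [Finset.sum_add_distrib, hbadsum]
        linarith
      _ ≤ (C + η) * (Λ.card * N) + δ / (4 * (N + 1) * (D + 1)) * Λ.card * N * D := by
        rw [hXcard]
        gcongr
      _ = _ := by ring
  have hmain' := le_of_mul_le_mul_left hmain hΛ0
  have h1 : ∑ t, cfcInner f A (lp.single 2 (c t) (1 : ℂ))
      ≤ ∑ t, (q (c t) + η) :=
    Finset.sum_le_sum fun t _ => hqinner (c t)
  rw [Finset.sum_add_distrib, Finset.sum_const, Finset.card_univ, nsmul_eq_mul, ← hN] at h1
  have h2 : η * N ≤ δ / 4 := by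
    rw [hη, div_mul_eq_mul_div, div_le_iff₀ (by positivity)]
    nlinarith
  have h3 : δ / (4 * (N + 1) * (D + 1)) * N * D ≤ δ / 4 := by
    rw [div_mul_eq_mul_div, div_mul_eq_mul_div, div_le_iff₀ (by positivity)]
    have : N * D ≤ (N + 1) * (D + 1) := by gcongr <;> linarith
    nlinarith
  linarith

end Approximation

/-! ### Logarithmic integrability -/

/-- A continuous function that vanishes at `0` and dominates the number of the intervals
`(a, 2⁻ᵐ]`, `m < M`, that contain a given point. -/
def layerCount (M : ℕ) (a x : ℝ) : ℝ :=
  ∑ m ∈ Finset.range M, (upperCutoff ((1 / 2) ^ m) x - lowerCutoff a x)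

theorem continuous_layerCount (M : ℕ) (a : ℝ) : Continuous (layerCount M a) :=
  continuous_finsetSum _ fun _ _ =>
    (continuous_upperCutoff _).sub (continuous_lowerCutoff a)

theorem layerCount_zero (M : ℕ) (a : ℝ) : layerCount M a 0 = 0 := by
  refine Finset.sum_eq_zero fun _ _ => ?_
  simp [upperCutoff, lowerCutoff]

/-- The upper cut-off vanishes from `2 * 2⁻ᵐ` on, whence the `2` in `2 / x`; the lower one is
nonnegative and is dropped. -/
theorem upperCutoff_sub_lowerCutoff_le (m : ℕ) (a : ℝ) {x : ℝ} (hx : 0 < x) :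
    upperCutoff ((1 / 2) ^ m) x - lowerCutoff a x ≤ if (2 : ℝ) ^ m < 2 / x then 1 else 0 := by
  have h0 : (0 : ℝ) < (1 / 2) ^ m := by positivity
  have h1 : 0 ≤ lowerCutoff a x := le_max_right _ _
  split_ifs with h
  · have h2 : (0 : ℝ) ≤ min 1 (max (x - (1 / 2) ^ m) 0 / (1 / 2) ^ m) :=
      le_min zero_le_one (div_nonneg (le_max_right _ _) h0.le)
    rw [upperCutoff]
    linarith
  · have h3 : (1 / 2 : ℝ) ^ m ≤ x - (1 / 2) ^ m := by
      have h4 := (div_le_iff₀ hx).1 (not_lt.1 h)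
      have h5 : (2 : ℝ) ^ m * (1 / 2) ^ m = 1 := by rw [← mul_pow]; norm_num
      nlinarith
    have h2 : (1 : ℝ) ≤ max (x - (1 / 2) ^ m) 0 / (1 / 2) ^ m :=
      (one_le_div h0).2 (h3.trans (le_max_left _ _))
    rw [upperCutoff, min_eq_left h2]
    linarith

/-- At most `⌊1 - log₂ x⌋ + 1` layers contain `x` when `x ≤ 2`, and none when `x > 2`. The term
`|log₂ K|` keeps the right side nonnegative in the second case. -/
theorem layerCount_le (M : ℕ) (a : ℝ) {x K : ℝ} (hx : 0 < x) (hxK : x ≤ K) :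
    layerCount M a x ≤ 2 + |Real.logb 2 K| - Real.logb 2 x := by
  have h1 : layerCount M a x ≤ ((Finset.range M).filter fun m => (2 : ℝ) ^ m < 2 / x).card := by
    refine (Finset.sum_le_sum fun m _ => upperCutoff_sub_lowerCutoff_le m a hx).trans_eq ?_
    rw [Finset.sum_boole]
  refine h1.trans ?_
  have hlog : Real.logb 2 x ≤ Real.logb 2 K := Real.logb_le_logb_of_le one_lt_two hx hxK
  have hd : Real.logb 2 (2 / x) = 1 - Real.logb 2 x := by
    rw [Real.logb_div two_ne_zero hx.ne', Real.logb_self_eq_one one_lt_two]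
  have hlt : ∀ m : ℕ, (2 : ℝ) ^ m < 2 / x → (m : ℝ) < 1 - Real.logb 2 x := by
    intro m hm
    rw [← hd, Real.lt_logb_iff_rpow_lt one_lt_two (by positivity), Real.rpow_natCast]
    exact hm
  rcases le_or_gt 1 (2 / x) with h | h
  · have h2 : 0 ≤ 1 - Real.logb 2 x := by
      rw [← hd]; exact Real.logb_nonneg one_lt_two h
    have h3 : ((Finset.range M).filter fun m => (2 : ℝ) ^ m < 2 / x)
        ⊆ Finset.range (⌊1 - Real.logb 2 x⌋₊ + 1) := by
      intro m hm
      exact Finset.mem_range.2 (Nat.lt_succ_of_le (Nat.le_floor (hlt m (Finset.mem_filter.1 hm).2).le))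
    have h4 := Finset.card_le_card h3
    rw [Finset.card_range] at h4
    have h5 := Nat.floor_le h2
    have h6 : ((((Finset.range M).filter fun m => (2 : ℝ) ^ m < 2 / x).card : ℕ) : ℝ)
        ≤ (⌊1 - Real.logb 2 x⌋₊ : ℝ) + 1 := by exact_mod_cast h4
    linarith [abs_nonneg (Real.logb 2 K)]
  · have h3 : ((Finset.range M).filter fun m => (2 : ℝ) ^ m < 2 / x) = ∅ := by
      refine Finset.filter_eq_empty_iff.2 fun m _ hm => ?_
      have : (1 : ℝ) ≤ 2 ^ m := one_le_pow₀ one_le_two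
      linarith
    rw [h3, Finset.card_empty, Nat.cast_zero]
    linarith [le_abs_self (Real.logb 2 K)]

/-- Zero eigenvalues contribute nothing, and the logarithms of the others have nonnegative sum by
integrality. The bound depends on neither `M` nor `a`, which is the point. -/
theorem sum_layerCount_eigenvalues_le {n : Type*} [Fintype n] [DecidableEq n] {B : Matrix n n ℂ}
    (hB : B.IsHermitian) (hint : ∀ s t, ∃ m : ℤ, B s t = m) {K : ℝ}
    (hK : ∀ i, hB.eigenvalues i ∈ Set.Icc 0 K) (M : ℕ) (a : ℝ) :
    ∑ i, layerCount M a (hB.eigenvalues i) ≤ (2 + |Real.logb 2 K|) * Fintype.card n := by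
  set ν : n → ℝ := fun i => if hB.eigenvalues i = 0 then 1 else |hB.eigenvalues i| with hν
  have hν0 : ∀ i, ν i ≠ 0 := by
    intro i
    simp only [hν]
    split_ifs with h
    · exact one_ne_zero
    · exact abs_ne_zero.2 h
  have h1 : ∀ i, layerCount M a (hB.eigenvalues i) ≤ 2 + |Real.logb 2 K| - Real.logb 2 (ν i) := by
    intro i
    simp only [hν]
    split_ifs with h
    · rw [h, layerCount_zero, Real.logb_one]
      linarith [abs_nonneg (Real.logb 2 K)]
    · rw [abs_of_nonneg (hK i).1]
      exact layerCount_le M a (lt_of_le_of_ne (hK i).1 (Ne.symm h)) (hK i).2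
  refine (Finset.sum_le_sum fun i _ => h1 i).trans ?_
  rw [Finset.sum_sub_distrib, Finset.sum_const, Finset.card_univ, nsmul_eq_mul,
    ← Real.logb_prod _ _ fun i _ => hν0 i]
  have h2 : 0 ≤ Real.logb 2 (∏ i, ν i) :=
    Real.logb_nonneg one_lt_two (one_le_prod_abs_eigenvalues hB hint)
  linarith

/-- With `k = ⌊log₂ (1/x)⌋`, the point lies in the intervals for `m = 0, …, k`, while `|log x| ≤
log₂ (1/x) < k + 1` because `log 2 ≤ 1`. -/
theorem abs_log_le_tsum_indicator {x : ℝ} (hx : x ∈ Set.Ioc (0 : ℝ) 1) :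
    ENNReal.ofReal |Real.log x| ≤ ∑' m : ℕ,
      (Set.Ioc (0 : ℝ) ((1 / 2) ^ m)).indicator (fun _ => (1 : ℝ≥0∞)) x := by
  set k := ⌊Real.logb 2 x⁻¹⌋₊ with hk
  have h0 : 0 ≤ Real.logb 2 x⁻¹ :=
    Real.logb_nonneg one_lt_two ((one_le_inv₀ hx.1).2 hx.2)
  have h1 : |Real.log x| ≤ k + 1 := by
    have h2 : Real.logb 2 x⁻¹ < k + 1 := Nat.lt_floor_add_one _
    have h3 : Real.log x⁻¹ = Real.logb 2 x⁻¹ * Real.log 2 := by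
      rw [Real.logb, div_mul_cancel₀ _ (Real.log_pos one_lt_two).ne']
    rw [← abs_neg, ← Real.log_inv, abs_of_nonneg (Real.log_nonneg ((one_le_inv₀ hx.1).2 hx.2)), h3]
    have h4 : Real.log 2 ≤ 1 := by linarith [Real.log_two_lt_d9]
    nlinarith [Real.log_pos one_lt_two]
  have h2 : ∀ m ∈ Finset.range (k + 1),
      (Set.Ioc (0 : ℝ) ((1 / 2) ^ m)).indicator (fun _ => (1 : ℝ≥0∞)) x = 1 := by
    intro m hm
    refine Set.indicator_of_mem (Set.mem_Ioc.2 ⟨hx.1, ?_⟩) _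
    have h3 : (m : ℝ) ≤ Real.logb 2 x⁻¹ :=
      (Nat.cast_le.2 (Nat.lt_succ_iff.1 (Finset.mem_range.1 hm))).trans (Nat.floor_le h0)
    rw [Real.le_logb_iff_rpow_le one_lt_two (inv_pos.2 hx.1), Real.rpow_natCast] at h3
    rw [one_div, inv_pow]
    exact (le_inv_comm₀ (by positivity) hx.1).1 h3
  calc ENNReal.ofReal |Real.log x| ≤ ENNReal.ofReal ((k + 1 : ℕ) : ℝ) :=
        ENNReal.ofReal_le_ofReal (by push_cast; exact h1)
    _ = ∑ m ∈ Finset.range (k + 1),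
        (Set.Ioc (0 : ℝ) ((1 / 2) ^ m)).indicator (fun _ => (1 : ℝ≥0∞)) x := by
        rw [Finset.sum_congr rfl h2, Finset.sum_const, Finset.card_range, nsmul_one,
          ENNReal.ofReal_natCast]
    _ ≤ _ := ENNReal.sum_le_tsum _

/-- A dyadic criterion for the integrability of the logarithm near `0`. -/
theorem integrableOn_log_of_sum_le (F : StieltjesFunction ℝ) {C : ℝ}
    (h : ∀ M : ℕ, ∑ m ∈ Finset.range M, (F ((1 / 2) ^ m) - F 0) ≤ C) :
    MeasureTheory.IntegrableOn Real.log (Set.Ioc 0 1) F.measure := by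
  refine ⟨Real.measurable_log.aestronglyMeasurable, ?_⟩
  rw [MeasureTheory.hasFiniteIntegral_iff_norm]
  have hle : ∀ m : ℕ, 0 ≤ F ((1 / 2) ^ m) - F 0 := fun m =>
    sub_nonneg.2 (F.mono (by positivity))
  calc ∫⁻ x in Set.Ioc 0 1, ENNReal.ofReal ‖Real.log x‖ ∂F.measure
      ≤ ∫⁻ x in Set.Ioc 0 1, ∑' m : ℕ,
        (Set.Ioc (0 : ℝ) ((1 / 2) ^ m)).indicator (fun _ => (1 : ℝ≥0∞)) x ∂F.measure :=
        MeasureTheory.setLIntegral_mono' measurableSet_Ioc fun x hx => abs_log_le_tsum_indicator hx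
    _ ≤ ∫⁻ x, ∑' m : ℕ,
        (Set.Ioc (0 : ℝ) ((1 / 2) ^ m)).indicator (fun _ => (1 : ℝ≥0∞)) x ∂F.measure :=
        MeasureTheory.setLIntegral_le_lintegral _ _
    _ = ∑' m : ℕ, ENNReal.ofReal (F ((1 / 2) ^ m) - F 0) := by
        rw [MeasureTheory.lintegral_tsum fun m =>
          (measurable_const.indicator measurableSet_Ioc).aemeasurable]
        refine tsum_congr fun m => ?_
        rw [MeasureTheory.lintegral_indicator measurableSet_Ioc,
          MeasureTheory.setLIntegral_const, one_mul, StieltjesFunction.measure_Ioc]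
    _ ≤ ENNReal.ofReal C := by
        refine ENNReal.tsum_le_of_sum_range_le fun M => ?_
        rw [← ENNReal.ofReal_sum_of_nonneg fun m _ => hle m]
        exact ENNReal.ofReal_le_ofReal (h M)
    _ < ⊤ := ENNReal.ofReal_lt_top

/-- The spectral form of the dyadic criterion. -/
theorem integrableOn_log_of_cfcInner_le {H : Type*} [NormedAddCommGroup H]
    [InnerProductSpace ℂ H] [CompleteSpace H] {T : Type*} [Fintype T] {A : H →L[ℂ] H}
    (hA : 0 ≤ A) (x : T → H) (F : StieltjesFunction ℝ)
    (hF : ∀ b, F b = ∑ t, (inner ℂ (spectralProjection A b (x t)) (x t)).re) {C : ℝ}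
    (hC : ∀ (M : ℕ) (a : ℝ), 0 < a → ∑ t, cfcInner (layerCount M a) A (x t) ≤ C) :
    MeasureTheory.IntegrableOn Real.log (Set.Ioc 0 1) F.measure := by
  have hsa : IsSelfAdjoint A := .of_nonneg hA
  refine integrableOn_log_of_sum_le F (C := C) fun M => ?_
  have h1 : ∀ a : ℝ, 0 < a → ∑ m ∈ Finset.range M, (F ((1 / 2) ^ m) - F a) ≤ C := by
    intro a ha
    refine le_trans ?_ (hC M a ha)
    have h2 : ∀ t, cfcInner (layerCount M a) A (x t) = ∑ m ∈ Finset.range M,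
        (cfcInner (upperCutoff ((1 / 2) ^ m)) A (x t) - cfcInner (lowerCutoff a) A (x t)) := by
      intro t
      refine (cfcInner_sum _ (f := fun m x => upperCutoff ((1 / 2) ^ m) x - lowerCutoff a x)
        (fun m => (continuous_upperCutoff _).sub (continuous_lowerCutoff a)) A (x t)).trans ?_
      exact Finset.sum_congr rfl fun m _ =>
        cfcInner_sub (continuous_upperCutoff _) (continuous_lowerCutoff a) _ _
    simp only [h2]
    rw [Finset.sum_comm]
    refine Finset.sum_le_sum fun m _ => ?_
    rw [hF, hF, ← Finset.sum_sub_distrib]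
    refine Finset.sum_le_sum fun t _ => sub_le_sub ?_ ?_
    · exact inner_spectralProjection_le_upperCutoff hsa (by positivity) _
    · exact inner_lowerCutoff_le_spectralProjection hA ha _
  -- The lower cut-off needs `a > 0`; right continuity of `F` at `0` removes it from the bound.
  have h3 : Filter.Tendsto (fun a => ∑ m ∈ Finset.range M, (F ((1 / 2) ^ m) - F a)) (𝓝[>] 0)
      (𝓝 (∑ m ∈ Finset.range M, (F ((1 / 2) ^ m) - F 0))) :=
    tendsto_finsetSum _ fun m _ => tendsto_const_nhds.sub
      (continuousWithinAt_Ioi_iff_Ici.2 (F.right_continuous 0))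
  exact le_of_tendsto h3 (Filter.eventually_of_mem self_mem_nhdsWithin fun a ha => h1 a ha)

/-- Let `A` be a positive operator on `ℓ²(S)` with integral matrix coefficients and finite
propagation, which is equivariant up to signs for a free cocompact action of an amenable group.
Then the logarithm is integrable near `0` for the spectral density function of `A`. -/
theorem integrableOn_log_of_isAmenable {S G T : Type*} [DecidableEq S] [Group G] [MulAction G S]
    [Fintype T] (hG : IsAmenable G) {c : T → S}
    (hc : Function.Bijective fun p : G × T => p.1 • c p.2)
    {A : lp (fun _ : S => ℂ) 2 →L[ℂ] lp (fun _ : S => ℂ) 2} (hA : 0 ≤ A)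
    {e : G → S → ℂ} (he : ∀ g s, e g s * e g s = 1) (hloc : IsLocallyIntegral e e A)
    (F : StieltjesFunction ℝ)
    (hF : ∀ b, F b = ∑ t, (inner ℂ (spectralProjection A b (lp.single 2 (c t) (1 : ℂ)))
      (lp.single 2 (c t) (1 : ℂ))).re) :
    MeasureTheory.IntegrableOn Real.log (Set.Ioc 0 1) F.measure := by
  refine integrableOn_log_of_cfcInner_le hA (fun t => lp.single 2 (c t) (1 : ℂ)) F hF
    (C := (2 + |Real.logb 2 ‖A‖|) * Fintype.card T) fun M a ha => ?_
  refine sum_cfcInner_le hG hc hA he hloc (continuous_layerCount M a) fun X hX => ?_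
  refine (sum_layerCount_eigenvalues_le hX (fun s t => hloc.integral t.1 s.1)
    (eigenvalues_truncation_mem hA X hX) M a).trans_eq ?_
  rw [Fintype.card_coe]

/-! ### The simplicial Laplacian -/

section Simplicial

variable {G V : Type*} [Group G] [LinearOrder V] [MulAction G V]

/-! ### Orientation signs: the action need not preserve the order of the vertices. -/

/-- The factor `-1` if `g` inverts the order of `u < w`, and `1` otherwise. -/
def inversionSign (g : G) (u w : V) : ℂ := if u < w ∧ g • w < g • u then -1 else 1

/-- The sign of the permutation that sorts the images under `g` of the vertices of `s`, that is,
the sign by which `g` changes the orientations given by the order of the vertices. -/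
def orientationSign (g : G) (s : Finset V) : ℂ := ∏ u ∈ s, ∏ w ∈ s, inversionSign g u w

theorem inversionSign_mul_self (g : G) (u w : V) :
    inversionSign g u w * inversionSign g u w = 1 := by
  unfold inversionSign; split_ifs <;> norm_num

theorem orientationSign_mul_self (g : G) (s : Finset V) :
    orientationSign g s * orientationSign g s = 1 := by
  simp only [orientationSign, ← Finset.prod_mul_distrib, inversionSign_mul_self,
    Finset.prod_const_one]

theorem star_orientationSign (g : G) (s : Finset V) :
    star (orientationSign g s) = orientationSign g s := by
  have h : ∀ u w : V, star (inversionSign g u w) = inversionSign g u w := by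
    intro u w; unfold inversionSign; split_ifs <;> simp
  simp only [orientationSign, star_prod, h]

theorem neg_one_pow_card_filter {ι : Type*} (s : Finset ι) (p : ι → Prop) [DecidablePred p] :
    (-1 : ℂ) ^ (s.filter p).card = ∏ u ∈ s, if p u then -1 else 1 := by
  rw [Finset.prod_ite, Finset.prod_const, Finset.prod_const_one, mul_one]

/-- Only the factor with its arguments in increasing order can be `-1`, so the product of the two
records whether `g` inverts the pair. -/
theorem inversionSign_mul_inversionSign (g : G) {u v : V} (h : u ≠ v) :
    inversionSign g v u * inversionSign g u v * (if u < v then (-1 : ℂ) else 1)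
      = if g • u < g • v then -1 else 1 := by
  have hg : g • u ≠ g • v := fun h' => h (MulAction.injective g h')
  unfold inversionSign
  rcases lt_or_gt_of_ne h with h1 | h1 <;> rcases lt_or_gt_of_ne hg with h2 | h2 <;>
    simp [h1, h2, h1.not_gt, h2.not_gt]

/-- The sign of a vertex in the boundary formula of `g • s`. -/
theorem neg_one_pow_card_filter_smul (g : G) {s : Finset V} {v : V} (hv : v ∈ s) :
    (-1 : ℂ) ^ ((g • s).filter (· < g • v)).card
      = orientationSign g (s.erase v) * orientationSign g s * (-1) ^ (s.filter (· < v)).card := by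
  obtain ⟨t, hvt, rfl⟩ : ∃ t, v ∉ t ∧ s = insert v t :=
    ⟨s.erase v, Finset.notMem_erase v s, (Finset.insert_erase hv).symm⟩
  have h1 : ((g • insert v t).filter (· < g • v)).card
      = ((insert v t).filter fun u => g • u < g • v).card := by
    rw [← Finset.image_smul, Finset.filter_image, Finset.card_image_of_injective _
      (MulAction.injective g)]
  -- The sign of `insert v t` differs from that of `t` by the pairs containing `v`. The sign of `t`
  -- squares to `1`, so the claim reduces to one identity for each `u ∈ t`.
  have h2 : orientationSign g (insert v t)
      = orientationSign g t * ∏ u ∈ t, inversionSign g v u * inversionSign g u v := by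
    have h3 : inversionSign g v v = 1 := by simp [inversionSign]
    simp only [orientationSign, Finset.prod_insert hvt, Finset.prod_mul_distrib, h3, one_mul]
    ring
  rw [Finset.erase_insert hvt, h1, h2, neg_one_pow_card_filter, neg_one_pow_card_filter,
    Finset.prod_insert hvt, Finset.prod_insert hvt, ← mul_assoc (orientationSign g t),
    orientationSign_mul_self, one_mul]
  simp only [lt_irrefl, if_false, one_mul, ← Finset.prod_mul_distrib]
  exact Finset.prod_congr rfl fun u hu =>
    (inversionSign_mul_inversionSign g (ne_of_mem_of_not_mem hu hvt)).symm

/-! ### The coboundary and the Laplacian as locally integral operators -/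

variable {Y : AbstractSimplicialComplex V}

instance [hY : Fact (FreeCocompact G Y)] (j : ℕ) : MulAction G (Simplex Y j) where
  smul g σ := ⟨g • σ.1, hY.out.simplicial g σ.1 σ.2.1, by
    rw [Finset.card_smul_finset, σ.2.2]⟩
  one_smul σ := Subtype.ext (one_smul G σ.1)
  mul_smul g h σ := Subtype.ext (mul_smul g h σ.1)

theorem Simplex.coe_smul [Fact (FreeCocompact G Y)] {j : ℕ} (g : G) (σ : Simplex Y j) :
    (g • σ).1 = g • σ.1 := rfl

theorem coboundary_single (hY : UniformlyLocallyFinite Y) {j : ℕ} (σ : Simplex Y j)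
    (τ : Simplex Y (j + 1)) :
    coboundary hY j (lp.single 2 σ (1 : ℂ)) τ
      = ∑ v ∈ τ.1, if τ.1.erase v = σ.1 then (-1 : ℂ) ^ (τ.1.filter (· < v)).card else 0 := by
  rw [coboundary_apply, coboundaryFun, ← Finset.sum_coe_sort τ.1]
  refine Finset.sum_congr rfl fun v _ => ?_
  rw [lp.single_apply, Pi.single_apply, mul_ite, mul_one, mul_zero]
  exact if_congr Subtype.ext_iff rfl rfl

theorem subset_of_coboundary_single_ne_zero (hY : UniformlyLocallyFinite Y) {j : ℕ}
    {σ : Simplex Y j} {τ : Simplex Y (j + 1)}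
    (h : coboundary hY j (lp.single 2 σ (1 : ℂ)) τ ≠ 0) : σ.1 ⊆ τ.1 := by
  rw [coboundary_single] at h
  obtain ⟨v, -, hv⟩ := Finset.exists_ne_zero_of_sum_ne_zero h
  rw [← (ite_ne_right_iff.1 hv).1]
  exact Finset.erase_subset _ _

/-- Columns are finite by local finiteness, rows because a simplex has finitely many faces.
Equivariance up to orientation signs is `neg_one_pow_card_filter_smul`, term by term. -/
theorem isLocallyIntegral_coboundary [Fact (FreeCocompact G Y)]
    (hY : UniformlyLocallyFinite Y) (j : ℕ) :
    IsLocallyIntegral (fun (g : G) (σ : Simplex Y j) => orientationSign g σ.1)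
      (fun (g : G) (τ : Simplex Y (j + 1)) => orientationSign g τ.1) (coboundary hY j) where
  finite_col σ := by
    obtain ⟨M, hM⟩ := hY j
    by_contra hinf
    obtain ⟨S, hS, hcard⟩ := Set.Infinite.exists_subset_card_eq hinf (M + 1)
    have := hM σ S fun τ hτ => subset_of_coboundary_single_ne_zero hY (hS hτ)
    omega
  finite_row τ := by
    refine (τ.1.powerset.finite_toSet.preimage Subtype.val_injective.injOn).subset fun σ hσ => ?_
    exact Finset.mem_coe.2 (Finset.mem_powerset.2 (subset_of_coboundary_single_ne_zero hY hσ))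
  integral σ τ := by
    refine ⟨∑ v ∈ τ.1, if τ.1.erase v = σ.1 then (-1) ^ (τ.1.filter (· < v)).card else 0, ?_⟩
    rw [coboundary_single]
    push_cast
    rfl
  equivariant g σ τ := by
    rw [coboundary_single, coboundary_single, Simplex.coe_smul, Simplex.coe_smul, Finset.mul_sum]
    conv_lhs => rw [← Finset.image_smul]
    rw [Finset.sum_image (MulAction.injective g).injOn]
    refine Finset.sum_congr rfl fun v hv => ?_
    have h1 : (g • τ.1).erase (g • v) = g • τ.1.erase v := by
      rw [← Finset.image_smul, ← Finset.image_smul, Finset.image_erase (MulAction.injective g)]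
    rw [Finset.image_smul, h1, neg_one_pow_card_filter_smul g hv, mul_ite, mul_zero]
    by_cases h : τ.1.erase v = σ.1
    · rw [if_pos (by rw [h]), if_pos h, h]
    · rw [if_neg fun h' => h (smul_left_cancel g h'), if_neg h]

theorem isLocallyIntegral_laplacian [Fact (FreeCocompact G Y)]
    (hY : UniformlyLocallyFinite Y) (j : ℕ) :
    IsLocallyIntegral (fun (g : G) (σ : Simplex Y j) => orientationSign g σ.1)
      (fun (g : G) (σ : Simplex Y j) => orientationSign g σ.1) (laplacian hY j) := by
  have hd := isLocallyIntegral_coboundary (G := G) hY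
  have hd' := fun j => (hd j).adjoint (fun g s => star_orientationSign g s.1)
    (fun g s => star_orientationSign g s.1)
  have hup := fun j => (hd' j).comp (hd j) fun g s => orientationSign_mul_self g s.1
  cases j with
  | zero => exact hup 0
  | succ j =>
    exact ((hd j).comp (hd' j) fun g s => orientationSign_mul_self g s.1).add (hup (j + 1))

theorem laplacian_nonneg (hY : UniformlyLocallyFinite Y) (j : ℕ) : 0 ≤ laplacian hY j := by
  rw [ContinuousLinearMap.nonneg_iff_isPositive]
  cases j with
  | zero => exact ContinuousLinearMap.isPositive_adjoint_comp_self _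
  | succ j =>
    exact (ContinuousLinearMap.isPositive_self_comp_adjoint _).add
      (ContinuousLinearMap.isPositive_adjoint_comp_self _)

/-- Orbit representatives form a fundamental domain; freeness on simplices makes the group element
unique. -/
theorem bijective_smul_out [hY : Fact (FreeCocompact G Y)] (j : ℕ) :
    Function.Bijective fun p : G × QuotientSimplex G Y j => p.1 • p.2.out := by
  constructor
  · rintro ⟨g, c⟩ ⟨g', c'⟩ h
    have h1 : g • c.out.1 = g' • c'.out.1 := congrArg Subtype.val h
    have h2 : orbitSetoid G Y j c.out c'.out :=
      MulAction.orbitRel_apply.2 ⟨g⁻¹ * g', by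
        change (g⁻¹ * g') • c'.out.1 = c.out.1
        rw [mul_smul, ← h1, inv_smul_smul]⟩
    have h3 : c = c' := by
      rw [← Quotient.out_eq c, ← Quotient.out_eq c']
      exact Quotient.sound h2
    subst h3
    have h4 : g'⁻¹ * g = 1 := hY.out.free _ _ c.out.2.1 (by rw [mul_smul, h1, inv_smul_smul])
    rw [inv_mul_eq_one.1 h4]
  · intro σ
    have h1 : orbitSetoid G Y j σ (Quotient.mk (orbitSetoid G Y j) σ).out :=
      (orbitSetoid G Y j).symm (Quotient.mk_out σ)
    obtain ⟨g, hg⟩ := MulAction.orbitRel_apply.1 h1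
    exact ⟨(g, _), Subtype.ext hg⟩

end Simplicial

end

end DetClass

theorem theorem0p2 {G V : Type*} [Group G] [LinearOrder V] [MulAction G V]
    (Y : AbstractSimplicialComplex V) (hconn : DetClass.IsConnectedComplex Y)
    (hfree : DetClass.FreeCocompact G Y) (hamen : DetClass.IsAmenable G) :
    DetClass.IsDeterminantClass hfree := by
  intro j
  have := Fact.mk hfree
  have := hfree.finite_quotientSimplex j
  have := Fintype.ofFinite (DetClass.QuotientSimplex G Y j)
  -- Here `T` is the set of orbits of `j`-simplices and `c` picks the same representatives as the
  -- trace, so the formula for `F` is the definition of the spectral density with the real part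
  -- taken termwise.
  exact DetClass.integrableOn_log_of_isAmenable hamen (DetClass.bijective_smul_out j)
    (DetClass.laplacian_nonneg _ j) (fun g s => DetClass.orientationSign_mul_self g s.1)
    (DetClass.isLocallyIntegral_laplacian _ j) (DetClass.spectralDensity hfree j)
    fun b => DetClass.re_vonNeumannTrace j _
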